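/- Let $(M,d,\mathbf m)$ be a complete metric space with a Radon measure $\mathbf m$ that is finite on bounded sets, and let $N\in\mathbb N$. For $f:M\to\mathbb R$ put $\operatorname{lip}f(x)=\limsup_{y\to x,\,y\ne x}\frac{|f(y)-f(x)|}{d(x,y)}$ (equal to $0$ at isolated points). Lipschitz functions $f_1,\dots,f_n$ are *independent* on $A\subset M$ if for $\mathbf m$-a.e. $x\in A$ the map $c\mapsto\operatorname{lip}\big(\sum_i c_if_i\big)(x)$ is a norm on $\mathbb R^n$. The space $(M,d,\mathbf m)$ is a *Lipschitz differentiability space with constant $N$* if at most $N$ Lipschitz functions can be independent on a Borel set of positive measure. For $p\in(1,\infty)$ let $\mathsf{Pfm}_p$ be the set of families $(f_i,A_i)_{i\in\mathbb N}$ where $(A_i)$ is a Borel partition of $M$, each $f_i$ is Lipschitz with $\operatorname{lip}f_i\in L^p(\mathbf m)$, and $\sum_i\int_{A_i}(\operatorname{lip}f_i)^p\,d\mathbf m<\infty$. It carries the pointwise norm $|(f_i,A_i)_i|=\operatorname{lip}f_i$ on $A_i$, the seminorm $\|v\|=\||v|\|_{L^p(\mathbf m)}$, and the piecewise linear operations,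 with $(f_i,A_i)_i+(h_j,B_j)_j=(f_i+h_j,A_i\cap B_j)_{i,j}$; two families are identified when their difference has pointwise norm $0$ a.e. The *$L^p$-Lipschitz module* $L^p_{\operatorname{lip}}(T^*M)$ is the completion of $\mathsf{Pfm}_p$, with $|\cdot|:L^p_{\operatorname{lip}}(T^*M)\to L^p(\mathbf m)$ extended by continuity. A set $S\subset L^p_{\operatorname{lip}}(T^*M)$ is *independent on $A$* if for any distinct $v_1,\dots,v_n\in S$ the map $c\mapsto|\sum_ic_iv_i|_x$ is a norm on $\mathbb R^n$ for $\mathbf m$-a.e. $x\in A$. The module is *locally finite dimensional with bound $N$* if there is a Borel partition $\{E_n\}_{n=0}^\infty\cup\{E_\infty\}$ of $M$ with $\mathbf m(E_\infty)=0$ and $\mathbf m(E_n)=0$ for all finite $n>N$, such that for every $n\in\mathbb N$ and every Borel $A\subset E_n$ with $\mathbf m(A)>0$, each set $S$ that is maximal among the sets that are independent on $A$ and whose elements vanish a.e. outside $A$ has exactly $n$ elements. Then the following are equivalent: 1. $(M,d,\mathbf m)$ is a Lipschitz differentiability space with constant $N$; 2. $L^p_{\operatorname{lip}}(T^*M)$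 is locally finite dimensional with bound $N$ for some $p\in(1,\infty)$; 3. $L^p_{\operatorname{lip}}(T^*M)$ is locally finite dimensional with bound $N$ for all $p\in(1,\infty)$. -/

import Mathlib

open MeasureTheory Filter Topology
open scoped ENNReal NNReal

noncomputable section

namespace LipMod

variable {M : Type*} [MetricSpace M]

/-- The local Lipschitz constant `lip f (x) = limsup_{y → x, y ≠ x} |f y - f x| / d(y, x)`,
with values in `[0, ∞]`; it is `0` at isolated points. -/
def locLip (f : M → ℝ) (x : M) : ℝ≥0∞ :=
  limsup (fun y => edist (f y) (f x) / edist y x) (𝓝[≠] x)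

theorem locLip_add_le (f g : M → ℝ) (x : M) :
    locLip (f + g) x ≤ locLip f x + locLip g x := by
  refine ENNReal.le_of_forall_pos_le_add fun ε hε htop => ?_
  have hf : locLip f x ≠ ∞ := fun h => by simp [h] at htop
  have hg : locLip g x ≠ ∞ := fun h => by simp [h] at htop
  have hε2 : (ε / 2 : ℝ≥0∞) ≠ 0 := by simp [hε.ne']
  have e1 := eventually_lt_of_limsup_lt (ENNReal.lt_add_right hf hε2)
  have e2 := eventually_lt_of_limsup_lt (ENNReal.lt_add_right hg hε2)
  have h : locLip (f + g) x ≤ (locLip f x + ε / 2) + (locLip g x + ε / 2) := by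
    refine limsup_le_of_le (by isBoundedDefault) ?_
    filter_upwards [e1, e2] with y h1 h2
    refine le_trans ?_ (add_le_add h1.le h2.le)
    simp only [Pi.add_apply]
    rw [← ENNReal.add_div]
    exact ENNReal.div_le_div_right (edist_add_add_le _ _ _ _) _
  refine h.trans (le_of_eq ?_)
  rw [add_add_add_comm, ENNReal.add_halves]

theorem locLip_smul (c : ℝ) (f : M → ℝ) (x : M) :
    locLip (c • f) x = ‖c‖ₑ * locLip f x := by
  unfold locLip
  rw [← ENNReal.limsup_const_mul_of_ne_top enorm_ne_top]
  congr 1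
  funext y
  simp only [Pi.smul_apply, edist_smul₀]
  rw [ENNReal.smul_def, smul_eq_mul, mul_div_assoc]
  rfl

theorem locLip_zero (x : M) : locLip (0 : M → ℝ) x = 0 := by
  have h := locLip_smul 0 (0 : M → ℝ) x
  simpa using h

theorem locLip_le {K : ℝ≥0} {f : M → ℝ} (hf : LipschitzWith K f) (x : M) :
    locLip f x ≤ K := by
  unfold locLip
  refine limsup_le_of_le (by isBoundedDefault) (Eventually.of_forall fun y => ?_)
  exact ENNReal.div_le_of_le_mul (hf y x)

theorem measurable_locLip [MeasurableSpace M] [BorelSpace M] {f : M → ℝ} (hf : Continuous f) :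
    Measurable (locLip f) := by
  have key : locLip f = fun x => ⨅ n : ℕ, ⨆ y ∈ {y : M | dist y x < 1 / ((n : ℝ) + 1) ∧ y ≠ x},
      edist (f y) (f x) / edist y x := by
    funext x
    have hb := nhdsWithin_hasBasis (Metric.nhds_basis_ball_inv_nat_succ (x := x)) {x}ᶜ
    unfold locLip
    rw [hb.limsup_eq_iInf_iSup]
    simp only [iInf_true]
    rfl
  rw [key]
  refine Measurable.iInf fun n => LowerSemicontinuous.measurable ?_
  rw [lowerSemicontinuous_iff_isOpen_preimage]
  intro c
  rw [isOpen_iff_mem_nhds]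
  intro x hx
  simp only [Set.mem_preimage, Set.mem_Ioi, lt_iSup_iff] at hx
  obtain ⟨y, ⟨hy1, hy2⟩, hy3⟩ := hx
  have e1 : ∀ᶠ z in 𝓝 x, dist y z < 1 / ((n : ℝ) + 1) :=
    (continuous_const.dist continuous_id).continuousAt.eventually_lt_const hy1
  have e2 : ∀ᶠ z in 𝓝 x, y ≠ z := by
    filter_upwards [isOpen_ne.mem_nhds hy2.symm] with z hz using hz.symm
  have e3 : ∀ᶠ z in 𝓝 x, c < edist (f y) (f z) / edist y z := by
    have hc : ContinuousAt (fun z => edist (f y) (f z) / edist y z) x := by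
      refine ENNReal.Tendsto.div
        (continuous_const.edist hf).continuousAt (Or.inr ?_)
        (continuous_const.edist continuous_id).continuousAt (Or.inr (edist_ne_top _ _))
      simpa using hy2
    exact hc.eventually_const_lt hy3
  filter_upwards [e1, e2, e3] with z h1 h2 h3
  simp only [Set.mem_preimage, Set.mem_Ioi, lt_iSup_iff]
  exact ⟨y, ⟨h1, h2⟩, h3⟩

/-- The pointwise norm `x ↦ lip (F x) (x)` of `F : M → (M → ℝ)`; if `F = f i` on `A i`
this is `lip (f i)` on `A i`. -/
def preNorm (F : M → M → ℝ) (x : M) : ℝ := (locLip (F x) x).toReal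

theorem preNorm_nonneg (F : M → M → ℝ) (x : M) : 0 ≤ preNorm F x := ENNReal.toReal_nonneg

theorem preNorm_smul (c : ℝ) (F : M → M → ℝ) (x : M) :
    preNorm (c • F) x = |c| * preNorm F x := by
  simp [preNorm, locLip_smul, ENNReal.toReal_mul]

variable [MeasurableSpace M]

/-- The domain of `f ↦ lip f`: Lipschitz functions with `lip f ∈ L^p(m)`. -/
def lipDomain (p : ℝ≥0∞) (m : Measure M) : Set (M → ℝ) :=
  {f | (∃ K : ℝ≥0, LipschitzWith K f) ∧ MemLp (fun x => (locLip f x).toReal) p m}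

/-- A family `(f i, A i)`, with `(A i)` a Borel partition and each `f i` in the domain of
`f ↦ lip f`, is encoded as the map `F` on `M` with `F x = f i` for `x ∈ A i`. -/
def IsPiecewise (p : ℝ≥0∞) (m : Measure M) (F : M → M → ℝ) : Prop :=
  ∃ (A : ℕ → Set M) (f : ℕ → M → ℝ), (∀ i, MeasurableSet (A i)) ∧
    Pairwise (fun i j => Disjoint (A i) (A j)) ∧ (⋃ i, A i) = Set.univ ∧
    (∀ i, f i ∈ lipDomain p m) ∧ ∀ i, ∀ x ∈ A i, F x = f i

theorem IsPiecewise.ne_top {p : ℝ≥0∞} {m : Measure M} {F : M → M → ℝ} (hF : IsPiecewise p m F)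
    (x : M) : locLip (F x) x ≠ ∞ := by
  obtain ⟨A, f, -, -, hU, hf, hFf⟩ := hF
  obtain ⟨i, hi⟩ := Set.mem_iUnion.1 (hU.symm ▸ Set.mem_univ x : x ∈ ⋃ i, A i)
  obtain ⟨K, hK⟩ := (hf i).1
  rw [hFf i x hi]
  exact ne_top_of_le_ne_top ENNReal.coe_ne_top (locLip_le hK x)

theorem preNorm_add_le {p : ℝ≥0∞} {m : Measure M} {F G : M → M → ℝ} (hF : IsPiecewise p m F)
    (hG : IsPiecewise p m G) (x : M) : preNorm (F + G) x ≤ preNorm F x + preNorm G x := by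
  unfold preNorm
  rw [← ENNReal.toReal_add (hF.ne_top x) (hG.ne_top x)]
  exact ENNReal.toReal_mono (ENNReal.add_ne_top.2 ⟨hF.ne_top x, hG.ne_top x⟩)
    (locLip_add_le _ _ _)

theorem lipDomain_smul {p : ℝ≥0∞} {m : Measure M} (c : ℝ) {f : M → ℝ} (hf : f ∈ lipDomain p m) :
    c • f ∈ lipDomain p m := by
  obtain ⟨⟨K, hK⟩, hf2⟩ := hf
  refine ⟨⟨‖c‖₊ * K, (lipschitzWith_smul c).comp hK⟩, ?_⟩
  have : (fun x => (locLip (c • f) x).toReal) = fun x => |c| * (locLip f x).toReal := by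
    funext x
    simp [locLip_smul, ENNReal.toReal_mul]
  rw [this]
  exact hf2.const_mul _

theorem IsPiecewise.zero {p : ℝ≥0∞} {m : Measure M} : IsPiecewise p m (0 : M → M → ℝ) := by
  refine ⟨fun k => if k = 0 then Set.univ else ∅, fun _ => 0, ?_, ?_, ?_, ?_, ?_⟩
  · intro i
    dsimp only
    split_ifs <;> simp
  · intro i j hij
    dsimp only
    split_ifs <;> simp_all
  · exact Set.eq_univ_of_forall fun x => Set.mem_iUnion.2 ⟨0, by simp⟩
  · exact fun i => ⟨⟨0, LipschitzWith.const 0⟩, by simp [locLip_zero]⟩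
  · intro i x _
    rfl

theorem IsPiecewise.smul {p : ℝ≥0∞} {m : Measure M} (c : ℝ) {F : M → M → ℝ}
    (hF : IsPiecewise p m F) : IsPiecewise p m (c • F) := by
  obtain ⟨A, f, hA, hAd, hAU, hf, hFf⟩ := hF
  refine ⟨A, fun k => c • f k, hA, hAd, hAU, fun k => lipDomain_smul c (hf k), ?_⟩
  intro k x hx
  simp only [Pi.smul_apply]
  rw [hFf k x hx]

variable [BorelSpace M]

theorem IsPiecewise.measurable_preNorm {p : ℝ≥0∞} {m : Measure M} {F : M → M → ℝ}
    (hF : IsPiecewise p m F) : Measurable (preNorm F) := by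
  obtain ⟨A, f, hA, -, hU, hf, hFf⟩ := hF
  intro s hs
  have : preNorm F ⁻¹' s = ⋃ i, A i ∩ (fun x => (locLip (f i) x).toReal) ⁻¹' s := by
    ext x
    obtain ⟨i, hi⟩ := Set.mem_iUnion.1 (hU.symm ▸ Set.mem_univ x : x ∈ ⋃ i, A i)
    simp only [Set.mem_preimage, Set.mem_iUnion, Set.mem_inter_iff, preNorm]
    constructor
    · intro h
      exact ⟨i, hi, by rwa [← hFf i x hi]⟩
    · rintro ⟨j, hj, h⟩
      rwa [hFf j x hj]
  rw [this]
  refine MeasurableSet.iUnion fun i => (hA i).inter ?_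
  obtain ⟨K, hK⟩ := (hf i).1
  exact (measurable_locLip hK.continuous).ennreal_toReal hs

theorem memLp_add {p : ℝ≥0∞} {m : Measure M} {F G : M → M → ℝ} (hF : IsPiecewise p m F)
    (hG : IsPiecewise p m G) (hFG : IsPiecewise p m (F + G))
    (h1 : MemLp (preNorm F) p m) (h2 : MemLp (preNorm G) p m) :
    MemLp (preNorm (F + G)) p m := by
  refine (h1.add h2).mono hFG.measurable_preNorm.aestronglyMeasurable
    (Eventually.of_forall fun x => ?_)
  rw [Real.norm_of_nonneg (preNorm_nonneg _ _)]
  exact (preNorm_add_le hF hG x).trans (le_abs_self _)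

theorem lipDomain_add {p : ℝ≥0∞} {m : Measure M} {f g : M → ℝ} (hf : f ∈ lipDomain p m)
    (hg : g ∈ lipDomain p m) : f + g ∈ lipDomain p m := by
  obtain ⟨⟨K, hK⟩, hf2⟩ := hf
  obtain ⟨⟨L, hL⟩, hg2⟩ := hg
  refine ⟨⟨K + L, hK.add hL⟩, (hf2.add hg2).mono
    (measurable_locLip (hK.add hL).continuous).ennreal_toReal.aestronglyMeasurable
    (Eventually.of_forall fun x => ?_)⟩
  have hf' := ne_top_of_le_ne_top ENNReal.coe_ne_top (locLip_le hK x)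
  have hg' := ne_top_of_le_ne_top ENNReal.coe_ne_top (locLip_le hL x)
  rw [Real.norm_of_nonneg ENNReal.toReal_nonneg]
  refine le_trans ?_ (le_abs_self _)
  simp only [Pi.add_apply]
  rw [← ENNReal.toReal_add hf' hg']
  exact ENNReal.toReal_mono (ENNReal.add_ne_top.2 ⟨hf', hg'⟩) (locLip_add_le _ _ _)


theorem IsPiecewise.add {p : ℝ≥0∞} {m : Measure M} {F G : M → M → ℝ} (hF : IsPiecewise p m F)
    (hG : IsPiecewise p m G) : IsPiecewise p m (F + G) := by
  obtain ⟨A, f, hA, hAd, hAU, hf, hFf⟩ := hF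
  obtain ⟨B, g, hB, hBd, hBU, hg, hGg⟩ := hG
  refine ⟨fun k => A k.unpair.1 ∩ B k.unpair.2, fun k => f k.unpair.1 + g k.unpair.2,
    fun k => (hA _).inter (hB _), ?_, ?_, fun k => lipDomain_add (hf _) (hg _), ?_⟩
  · intro i j hij
    have : i.unpair.1 ≠ j.unpair.1 ∨ i.unpair.2 ≠ j.unpair.2 := by
      by_contra! h
      apply hij
      rw [← Nat.pair_unpair i, ← Nat.pair_unpair j, h.1, h.2]
    rcases this with h | h
    · exact (hAd h).mono Set.inter_subset_left Set.inter_subset_left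
    · exact (hBd h).mono Set.inter_subset_right Set.inter_subset_right
  · refine Set.eq_univ_of_forall fun x => ?_
    obtain ⟨i, hi⟩ := Set.mem_iUnion.1 (hAU.symm ▸ Set.mem_univ x : x ∈ ⋃ i, A i)
    obtain ⟨j, hj⟩ := Set.mem_iUnion.1 (hBU.symm ▸ Set.mem_univ x : x ∈ ⋃ i, B i)
    exact Set.mem_iUnion.2 ⟨Nat.pair i j, by simpa using ⟨hi, hj⟩⟩
  · rintro k x ⟨h1, h2⟩
    simp only [Pi.add_apply]
    rw [hFf _ x h1, hGg _ x h2]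

/-- The set `Pfm` of families `(f i, A i)` with `∑ i, ∫_{A i} (lip (f i)) ^ p dm < ∞`,
as a vector space. -/
def pfmSubmodule (p : ℝ≥0∞) (m : Measure M) : Submodule ℝ (M → M → ℝ) where
  carrier := {F | IsPiecewise p m F ∧ MemLp (preNorm F) p m}
  add_mem' := fun hF hG => ⟨hF.1.add hG.1, memLp_add hF.1 hG.1 (hF.1.add hG.1) hF.2 hG.2⟩
  zero_mem' := by
    refine ⟨IsPiecewise.zero, ?_⟩
    have : preNorm (0 : M → M → ℝ) = 0 := by
      funext x
      simp [preNorm, locLip_zero]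
    rw [this]
    exact MemLp.zero
  smul_mem' := by
    rintro c F ⟨h1, h2⟩
    refine ⟨h1.smul c, ?_⟩
    have : preNorm (c • F) = fun x => |c| * preNorm F x := funext fun x => preNorm_smul c F x
    rw [this]
    exact h2.const_mul _

/-- `Pfm` as a type of its own; its topology comes from the seminorm below. -/
def Pfm (p : ℝ≥0∞) (m : Measure M) : Type _ := pfmSubmodule p m

instance (p : ℝ≥0∞) (m : Measure M) : AddCommGroup (Pfm p m) :=
  inferInstanceAs (AddCommGroup (pfmSubmodule p m))

instance (p : ℝ≥0∞) (m : Measure M) : Module ℝ (Pfm p m) :=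
  inferInstanceAs (Module ℝ (pfmSubmodule p m))

variable {p : ℝ≥0∞} {m : Measure M}

/-- The map `x ↦ f i` on `A i` that encodes an element of `Pfm`. -/
def Pfm.toFun (F : Pfm p m) : M → M → ℝ := F.1

theorem Pfm.toFun_add (F G : Pfm p m) : (F + G).toFun = F.toFun + G.toFun := rfl

theorem Pfm.toFun_smul (c : ℝ) (F : Pfm p m) : (c • F).toFun = c • F.toFun := rfl

theorem Pfm.isPiecewise (F : Pfm p m) : IsPiecewise p m F.toFun := F.2.1

theorem Pfm.memLp (F : Pfm p m) : MemLp (preNorm F.toFun) p m := F.2.2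

/-- The pointwise norm of an element of `Pfm`: the class of `lip (f i)` on `A i`. -/
def Pfm.pnorm (F : Pfm p m) : Lp ℝ p m := F.memLp.toLp _

theorem Pfm.coeFn_pnorm (F : Pfm p m) : F.pnorm =ᵐ[m] preNorm F.toFun := F.memLp.coeFn_toLp

variable [Fact (1 ≤ p)]

theorem Pfm.norm_pnorm_smul (c : ℝ) (F : Pfm p m) : ‖(c • F).pnorm‖ = ‖c‖ * ‖F.pnorm‖ := by
  have : (c • F).pnorm = |c| • F.pnorm := by
    apply Lp.ext
    filter_upwards [(c • F).coeFn_pnorm, F.coeFn_pnorm, Lp.coeFn_smul |c| F.pnorm] with x h1 h2 h3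
    rw [h1, h3, Pi.smul_apply, h2, Pfm.toFun_smul, preNorm_smul, smul_eq_mul]
  rw [this, norm_smul, Real.norm_eq_abs, Real.norm_eq_abs, abs_abs]

theorem Pfm.norm_pnorm_add_le (F G : Pfm p m) :
    ‖(F + G).pnorm‖ ≤ ‖F.pnorm‖ + ‖G.pnorm‖ := by
  refine le_trans (Lp.norm_le_norm_of_ae_le ?_) (norm_add_le F.pnorm G.pnorm)
  filter_upwards [(F + G).coeFn_pnorm, F.coeFn_pnorm, G.coeFn_pnorm,
    Lp.coeFn_add F.pnorm G.pnorm] with x h1 h2 h3 h4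
  rw [h1, h4, Pi.add_apply, h2, h3, Pfm.toFun_add, Real.norm_of_nonneg (preNorm_nonneg _ _)]
  exact (preNorm_add_le F.isPiecewise G.isPiecewise x).trans (le_abs_self _)

/-- The seminorm `‖F‖ = ‖|F|‖_{L^p}` on `Pfm`. -/
def pfmSeminorm (p : ℝ≥0∞) (m : Measure M) [Fact (1 ≤ p)] : Seminorm ℝ (Pfm p m) :=
  Seminorm.of (fun F => ‖F.pnorm‖) Pfm.norm_pnorm_add_le Pfm.norm_pnorm_smul

instance (p : ℝ≥0∞) (m : Measure M) [Fact (1 ≤ p)] : SeminormedAddCommGroup (Pfm p m) :=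
  (pfmSeminorm p m).toAddGroupSeminorm.toSeminormedAddCommGroup

theorem Pfm.norm_def (F : Pfm p m) : ‖F‖ = ‖F.pnorm‖ := rfl

instance (p : ℝ≥0∞) (m : Measure M) [Fact (1 ≤ p)] : NormedSpace ℝ (Pfm p m) where
  norm_smul_le c F := (Pfm.norm_pnorm_smul c F).le

/-- The `L^p`-Lipschitz module `L^p_lip(T^*M)`: the (Hausdorff) completion of `Pfm`, in which
`F` and `G` are identified if `|F - G| = 0` almost everywhere. -/
abbrev LipModule (p : ℝ≥0∞) (m : Measure M) [Fact (1 ≤ p)] : Type _ :=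
  UniformSpace.Completion (Pfm p m)

/-- The pointwise norm `v ↦ |v|` from the `L^p`-Lipschitz module to `L^p(m)`, the continuous
extension of the pointwise norm on `Pfm`. -/
def LipModule.pnorm (v : LipModule p m) : Lp ℝ p m :=
  UniformSpace.Completion.extension (fun F : Pfm p m => F.pnorm) v

theorem Pfm.lipschitzWith_pnorm : LipschitzWith 1 (fun F : Pfm p m => F.pnorm) := by
  refine LipschitzWith.of_dist_le_mul fun F G => ?_
  rw [NNReal.coe_one, one_mul, dist_eq_norm, dist_eq_norm, Pfm.norm_def]
  refine Lp.norm_le_norm_of_ae_le ?_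
  filter_upwards [F.coeFn_pnorm, G.coeFn_pnorm, (F - G).coeFn_pnorm,
    Lp.coeFn_sub F.pnorm G.pnorm] with x h1 h2 h3 h4
  rw [h4, Pi.sub_apply, h1, h2, h3, Real.norm_of_nonneg (preNorm_nonneg _ _), Real.norm_eq_abs,
    abs_le]
  have a1 := preNorm_add_le (F - G).isPiecewise G.isPiecewise x
  have a2 := preNorm_add_le (G - F).isPiecewise F.isPiecewise x
  have a3 : preNorm (G - F).toFun x = preNorm (F - G).toFun x := by
    have := preNorm_smul (-1) (F - G).toFun x
    rw [← Pfm.toFun_smul, neg_one_smul, neg_sub] at this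
    simpa using this
  rw [← Pfm.toFun_add, sub_add_cancel] at a1 a2
  constructor <;> linarith

theorem LipModule.pnorm_coe (F : Pfm p m) : LipModule.pnorm (F : LipModule p m) = F.pnorm :=
  UniformSpace.Completion.extension_coe Pfm.lipschitzWith_pnorm.uniformContinuous F

theorem LipModule.continuous_pnorm : Continuous (LipModule.pnorm : LipModule p m → Lp ℝ p m) :=
  UniformSpace.Completion.continuous_extension

/-- A set `S` of elements of the module is locally independent on `A` if for finitely many
distinct `v ∈ S` and almost every `x ∈ A` the map `c ↦ |∑ v, c v • v|_x` is a norm.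
The seminorm `ρ x` is the pointwise version of the classes `|∑ v, c v • v| ∈ L^p(m)`; it is
determined by them for almost every `x`. -/
def LocallyIndependent (S : Set (LipModule p m)) (A : Set M) : Prop :=
  ∀ T : Finset (LipModule p m), (T : Set (LipModule p m)) ⊆ S →
    ∃ ρ : M → Seminorm ℝ (T → ℝ),
      (∀ c : T → ℝ, (LipModule.pnorm (∑ v : T, c v • (v : LipModule p m)) : M → ℝ)
        =ᵐ[m] fun x => ρ x c) ∧
      ∀ᵐ x ∂m, x ∈ A → ∀ c : T → ℝ, ρ x c = 0 → c = 0

/-- `{v ≠ 0} ⊆ A` up to a null set. -/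
def SupportedOn (v : LipModule p m) (A : Set M) : Prop :=
  ∀ᵐ x ∂m, x ∉ A → (v.pnorm : M → ℝ) x = 0

/-- `S` is a maximal independent set on `A` among the sets of elements that vanish almost
everywhere outside `A`. -/
def IsMaximalIndependent (S : Set (LipModule p m)) (A : Set M) : Prop :=
  Maximal (fun S' : Set (LipModule p m) =>
    LocallyIndependent S' A ∧ ∀ v ∈ S', SupportedOn v A) S

/-- The `L^p`-Lipschitz module has local finite dimension bounded by `N`: there is a Borel
partition `(E n)`, `n ∈ ℕ ∪ {∞}`, with `E ∞` null, such that for every finite `n` each maximal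
independent set on each non-null Borel subset of `E n` has cardinality `n`, and `E n` is null
for `n > N`. -/
def LipModuleLocallyFiniteDimensional (p : ℝ≥0∞) [Fact (1 ≤ p)] (m : Measure M) (N : ℕ) : Prop :=
  ∃ E : ℕ∞ → Set M, (∀ n, MeasurableSet (E n)) ∧
    Pairwise (fun i j => Disjoint (E i) (E j)) ∧ (⋃ n, E n) = Set.univ ∧ m (E ⊤) = 0 ∧
    (∀ n : ℕ, ∀ A ⊆ E n, MeasurableSet A → m A ≠ 0 →
      ∀ S : Set (LipModule p m), IsMaximalIndependent S A → S.encard = n) ∧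
    ∀ n : ℕ, N < n → m (E n) = 0

/-- Functions `f 1, …, f n` are independent on `A` if for almost every `x ∈ A` the map
`c ↦ lip (∑ i, c i • f i) (x)` is a norm. -/
def LipIndependent (m : Measure M) {n : ℕ} (f : Fin n → M → ℝ) (A : Set M) : Prop :=
  ∀ᵐ x ∂m, x ∈ A → ∀ c : Fin n → ℝ, locLip (∑ i, c i • f i) x = 0 → c = 0

/-- `(M, d, m)` is a Lipschitz differentiability space with constant `N`: at most `N` Lipschitz
functions can be independent on a Borel set of positive measure. -/
def IsLipschitzDifferentiabilitySpace (m : Measure M) (N : ℕ) : Prop :=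
  ∀ (n : ℕ) (f : Fin n → M → ℝ), (∀ i, ∃ K : ℝ≥0, LipschitzWith K (f i)) →
    ∀ A : Set M, MeasurableSet A → m A ≠ 0 → LipIndependent m f A → n ≤ N

end LipMod

end

/-! The module is only a completion, so its elements have no values at points. The main device is to
create them: an element `v` is an almost everywhere limit of a sequence in `Pfm`, and its value at
`x` is the class of that sequence, evaluated at `x`, modulo sequences with `limsup_k lip (g k) (x) =
0`. Almost everywhere this class does not depend on the sequence, and its extended seminorm is
`|v|_x`. Independence in the module thus becomes linear independence of values at almost every point
(`locallyIndependent_iff`), and linear algebra applies pointwise.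

Two transfers connect the module with Lipschitz functions. Given `n` independent elements, close
approximants are still independent at each point, and on countably many pieces these are Lipschitz
functions, so one piece of positive measure carries `n` independent functions
(`LocallyIndependent.exists_isLipChart`). Conversely, if `n` functions are independent near almost
every point of `A`, fewer than `n` elements cannot span their germs. A measurable choice of a
function outside the span, truncated and scaled to stay in `L^p`, gives a new independent element
(`exists_pfm_notMem_span`).

Hence a maximal independent set on `A` has exactly `n` elements when `A` is covered by sets with `n`
independent functions and no non-null subset carries `n + 1`. The partition consists of the level
sets of the largest such `n`. None of this depends on the exponent. -/

noncomputable section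

namespace LipMod

/-! ### Sequences of functions modulo the local Lipschitz constant at a point. -/

section Stalk

variable {M : Type*} [MetricSpace M]

/-- The extended seminorm `limsup_k lip (g k) (x)` of a sequence of functions. -/
def stalkNorm (x : M) (g : ℕ → M → ℝ) : ℝ≥0∞ := limsup (fun k => locLip (g k) x) atTop

theorem stalkNorm_add_le (x : M) (g h : ℕ → M → ℝ) :
    stalkNorm x (g + h) ≤ stalkNorm x g + stalkNorm x h := by
  refine ENNReal.le_of_forall_pos_le_add fun ε hε htop => ?_
  have hg : stalkNorm x g ≠ ∞ := fun h => by simp [h] at htop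
  have hh : stalkNorm x h ≠ ∞ := fun h => by simp [h] at htop
  have hε2 : (ε / 2 : ℝ≥0∞) ≠ 0 := by simp [hε.ne']
  have e1 := eventually_lt_of_limsup_lt (ENNReal.lt_add_right hg hε2)
  have e2 := eventually_lt_of_limsup_lt (ENNReal.lt_add_right hh hε2)
  have h : stalkNorm x (g + h) ≤ (stalkNorm x g + ε / 2) + (stalkNorm x h + ε / 2) := by
    refine limsup_le_of_le (by isBoundedDefault) ?_
    filter_upwards [e1, e2] with k h1 h2
    exact (locLip_add_le _ _ x).trans (add_le_add h1.le h2.le)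
  refine h.trans (le_of_eq ?_)
  rw [add_add_add_comm, ENNReal.add_halves]

theorem stalkNorm_smul (x : M) (c : ℝ) (g : ℕ → M → ℝ) :
    stalkNorm x (c • g) = ‖c‖ₑ * stalkNorm x g := by
  unfold stalkNorm
  rw [← ENNReal.limsup_const_mul_of_ne_top enorm_ne_top]
  simp [locLip_smul]

theorem stalkNorm_zero (x : M) : stalkNorm x 0 = 0 := by
  simp [stalkNorm, locLip_zero]

@[simp]
theorem stalkNorm_const (x : M) (f : M → ℝ) : stalkNorm x (fun _ => f) = locLip f x := by
  simp [stalkNorm]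

theorem stalkNorm_sum_le {ι : Type*} (s : Finset ι) (x : M) (c : ι → ℝ) (g : ι → ℕ → M → ℝ) :
    stalkNorm x (∑ i ∈ s, c i • g i) ≤ ∑ i ∈ s, ‖c i‖ₑ * stalkNorm x (g i) := by
  classical
  induction s using Finset.induction_on with
  | empty => simp [stalkNorm_zero]
  | insert a s ha ih =>
    rw [Finset.sum_insert ha, Finset.sum_insert ha]
    refine (stalkNorm_add_le _ _ _).trans (add_le_add (stalkNorm_smul _ _ _).le ih)

/-- The sequences with vanishing extended seminorm at `x`. -/
def stalkKer (x : M) : Submodule ℝ (ℕ → M → ℝ) where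
  carrier := {g | stalkNorm x g = 0}
  add_mem' := fun {g h} hg hh => by
    have := stalkNorm_add_le x g h
    simp only [Set.mem_ofPred_eq] at hg hh ⊢
    rwa [hg, hh, add_zero, nonpos_iff_eq_zero] at this
  zero_mem' := stalkNorm_zero x
  smul_mem' := fun c g hg => by
    simp only [Set.mem_ofPred_eq] at hg ⊢
    rw [stalkNorm_smul, hg, mul_zero]

/-- The class of a sequence of functions modulo `stalkKer x`. -/
def germ (x : M) : (ℕ → M → ℝ) →ₗ[ℝ] (ℕ → M → ℝ) ⧸ stalkKer x := (stalkKer x).mkQ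

theorem germ_eq_zero {x : M} {g : ℕ → M → ℝ} : germ x g = 0 ↔ stalkNorm x g = 0 :=
  Submodule.Quotient.mk_eq_zero _

theorem germ_eq_germ {x : M} {g h : ℕ → M → ℝ} :
    germ x g = germ x h ↔ stalkNorm x (g - h) = 0 := by
  rw [← germ_eq_zero, map_sub, sub_eq_zero]

theorem linearIndependent_germ_iff {ι : Type*} [Fintype ι] {x : M} {g : ι → ℕ → M → ℝ} :
    LinearIndependent ℝ (fun i => germ x (g i)) ↔
      ∀ c : ι → ℝ, stalkNorm x (∑ i, c i • g i) = 0 → c = 0 := by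
  rw [Fintype.linearIndependent_iff]
  refine forall_congr' fun c => ?_
  rw [← germ_eq_zero, map_sum, funext_iff]
  simp

theorem linearIndependent_germ_const_iff {n : ℕ} {x : M} {f : Fin n → M → ℝ} :
    LinearIndependent ℝ (fun i => germ x (fun _ => f i)) ↔
      ∀ c : Fin n → ℝ, locLip (∑ i, c i • f i) x = 0 → c = 0 := by
  rw [linearIndependent_germ_iff]
  refine forall_congr' fun c => ?_
  rw [← stalkNorm_const]
  have : (∑ i, c i • fun _ : ℕ => f i) = fun _ => ∑ i, c i • f i := by
    funext k
    simp
  rw [this]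

/-- The seminorm `c ↦ limsup_k lip (∑ i, c i • g i k) (x)` (zero if not all `g i` have finite
`stalkNorm`). -/
def stalkSeminorm {ι : Type*} [Fintype ι] (x : M) (g : ι → ℕ → M → ℝ) : Seminorm ℝ (ι → ℝ) :=
  open Classical in
  if h : ∀ i, stalkNorm x (g i) ≠ ∞ then
    have hfin : ∀ c : ι → ℝ, stalkNorm x (∑ i, c i • g i) ≠ ∞ := fun c =>
      ne_top_of_le_ne_top
        (ENNReal.sum_ne_top.2 fun i _ => ENNReal.mul_ne_top enorm_ne_top (h i))
        (stalkNorm_sum_le _ _ _ _)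
    Seminorm.of (fun c => (stalkNorm x (∑ i, c i • g i)).toReal)
      (fun c d => by
        rw [← ENNReal.toReal_add (hfin c) (hfin d)]
        refine ENNReal.toReal_mono (ENNReal.add_ne_top.2 ⟨hfin c, hfin d⟩) ?_
        refine le_trans (le_of_eq ?_) (stalkNorm_add_le _ _ _)
        simp [add_smul, Finset.sum_add_distrib])
      (fun a c => by
        have : ∑ i, (a • c) i • g i = a • ∑ i, c i • g i := by
          simp [Finset.smul_sum, smul_smul]
        rw [this, stalkNorm_smul, ENNReal.toReal_mul, toReal_enorm])
  else 0

theorem stalkSeminorm_apply {ι : Type*} [Fintype ι] {x : M} {g : ι → ℕ → M → ℝ}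
    (h : ∀ i, stalkNorm x (g i) ≠ ∞) (c : ι → ℝ) :
    stalkNorm x (∑ i, c i • g i) = ENNReal.ofReal (stalkSeminorm x g c) := by
  have hfin : stalkNorm x (∑ i, c i • g i) ≠ ∞ := ne_top_of_le_ne_top
    (ENNReal.sum_ne_top.2 fun i _ => ENNReal.mul_ne_top enorm_ne_top (h i))
    (stalkNorm_sum_le _ _ _ _)
  rw [stalkSeminorm, dif_pos h]
  exact (ENNReal.ofReal_toReal hfin).symm

theorem continuous_seminorm_pi {ι : Type*} [Fintype ι] (ρ : Seminorm ℝ (ι → ℝ)) :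
    Continuous ρ :=
  ρ.convexOn.locallyLipschitz.continuous

/-- By compactness `ρ` has a positive minimum on the unit sphere. The constant is a natural number
so that independence becomes a countable union of conditions. -/
theorem exists_nat_norm_le_mul_seminorm {ι : Type*} [Fintype ι] {ρ : Seminorm ℝ (ι → ℝ)}
    (h : ∀ c, ρ c = 0 → c = 0) : ∃ n : ℕ, ∀ c, ‖c‖ ≤ n * ρ c := by
  have hρ := continuous_seminorm_pi ρ
  -- An empty sphere means that `c = 0` is the only vector.
  rcases (Metric.sphere (0 : ι → ℝ) 1).eq_empty_or_nonempty with he | hne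
  · refine ⟨0, fun c => ?_⟩
    by_cases hc : c = 0
    · simp [hc]
    · exfalso
      have : ‖c‖⁻¹ • c ∈ Metric.sphere (0 : ι → ℝ) 1 := by
        simp [norm_smul, inv_mul_cancel₀ (norm_ne_zero_iff.2 hc)]
      simp [he] at this
  · obtain ⟨u, hu, hmin⟩ := (isCompact_sphere (0 : ι → ℝ) 1).exists_isMinOn hne hρ.continuousOn
    have hu0 : 0 < ρ u := by
      refine lt_of_le_of_ne (apply_nonneg ρ u) fun h0 => ?_
      have := h u h0.symm
      simp [this] at hu
    obtain ⟨n, hn⟩ := exists_nat_ge (ρ u)⁻¹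
    refine ⟨n, fun c => ?_⟩
    by_cases hc : c = 0
    · simp [hc]
    have hc' : 0 < ‖c‖ := norm_pos_iff.2 hc
    have hmem : ‖c‖⁻¹ • c ∈ Metric.sphere (0 : ι → ℝ) 1 := by
      simp [norm_smul, inv_mul_cancel₀ hc'.ne']
    have h1 : ρ u ≤ ‖c‖⁻¹ * ρ c := by
      have := hmin hmem
      simpa [map_smul_eq_mul] using this
    have h2 : ‖c‖ * ρ u ≤ ρ c := by
      calc ‖c‖ * ρ u ≤ ‖c‖ * (‖c‖⁻¹ * ρ c) := by gcongr
        _ = ρ c := by field_simp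
    have h3 : 1 ≤ n * ρ u := by
      calc (1 : ℝ) = (ρ u)⁻¹ * ρ u := (inv_mul_cancel₀ hu0.ne').symm
        _ ≤ n * ρ u := by gcongr
    calc ‖c‖ = ‖c‖ * 1 := (mul_one _).symm
      _ ≤ ‖c‖ * (n * ρ u) := by gcongr
      _ = n * (‖c‖ * ρ u) := by ring
      _ ≤ n * ρ c := by gcongr

theorem denseRange_ratCast_pi (ι : Type*) [Finite ι] :
    DenseRange (fun (q : ι → ℚ) (i : ι) => (q i : ℝ)) :=
  DenseRange.piMap fun _ => Rat.denseRange_cast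

/-- Linear independence of germs, in terms of countably many inequalities. -/
theorem linearIndependent_germ_iff_rat {ι : Type*} [Fintype ι] {x : M} {g : ι → ℕ → M → ℝ}
    (h : ∀ i, stalkNorm x (g i) ≠ ∞) :
    LinearIndependent ℝ (fun i => germ x (g i)) ↔
      ∃ n : ℕ, ∀ q : ι → ℚ, ‖fun i => (q i : ℝ)‖ₑ ≤ n * stalkNorm x (∑ i, (q i : ℝ) • g i) := by
  have key : ∀ (n : ℕ) (c : ι → ℝ), ‖c‖ₑ ≤ n * stalkNorm x (∑ i, c i • g i) ↔
      ‖c‖ ≤ n * stalkSeminorm x g c := by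
    intro n c
    rw [stalkSeminorm_apply h, ← ofReal_norm, ← ENNReal.ofReal_natCast,
      ← ENNReal.ofReal_mul (Nat.cast_nonneg n), ENNReal.ofReal_le_ofReal_iff
        (mul_nonneg (Nat.cast_nonneg n) (apply_nonneg _ _))]
  have hzero : ∀ c : ι → ℝ, stalkNorm x (∑ i, c i • g i) = 0 ↔ stalkSeminorm x g c = 0 := by
    intro c
    rw [stalkSeminorm_apply h, ENNReal.ofReal_eq_zero]
    exact ⟨fun h => le_antisymm h (apply_nonneg _ _), fun h => h.le⟩
  rw [linearIndependent_germ_iff]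
  simp only [hzero]
  constructor
  · intro h0
    obtain ⟨n, hn⟩ := exists_nat_norm_le_mul_seminorm h0
    exact ⟨n, fun q => (key n _).2 (hn _)⟩
  -- A seminorm may vanish only in irrational directions, so definiteness on rational vectors is not
  -- enough; the bound with fixed `n` is a closed condition and passes to real `c`.
  · rintro ⟨n, hn⟩ c hc
    have hcl : IsClosed {c : ι → ℝ | ‖c‖ ≤ n * stalkSeminorm x g c} :=
      isClosed_le continuous_norm (continuous_const.mul (continuous_seminorm_pi _))
    have := (denseRange_ratCast_pi ι).induction_on
      (p := fun c => ‖c‖ ≤ n * stalkSeminorm x g c) c hcl (fun q => (key n _).1 (hn q))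
    rw [hc, mul_zero] at this
    exact norm_le_zero_iff.1 this

/-- If a family of sequences is independent at `x`, then so are the members of index `k`, once
these are close enough to the sequences. -/
theorem exists_linearIndependent_germ_const {ι : Type*} [Fintype ι] {x : M} {g : ι → ℕ → M → ℝ}
    (h : ∀ i, stalkNorm x (g i) ≠ ∞)
    (hg : ∀ i, Tendsto (fun k => stalkNorm x (g i - fun _ => g i k)) atTop (𝓝 0))
    (hind : LinearIndependent ℝ (fun i => germ x (g i))) :
    ∃ k, LinearIndependent ℝ (fun i => germ x (fun _ => g i k)) := by
  rw [linearIndependent_germ_iff] at hind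
  have h0 : ∀ c : ι → ℝ, stalkSeminorm x g c = 0 → c = 0 := by
    intro c hc
    apply hind
    rw [stalkSeminorm_apply h, hc, ENNReal.ofReal_zero]
  obtain ⟨n, hn⟩ := exists_nat_norm_le_mul_seminorm h0
  have hn' : ∀ c : ι → ℝ, ‖c‖ₑ ≤ n * stalkNorm x (∑ i, c i • g i) := by
    intro c
    rw [stalkSeminorm_apply h, ← ofReal_norm, ← ENNReal.ofReal_natCast,
      ← ENNReal.ofReal_mul (Nat.cast_nonneg n)]
    exact ENNReal.ofReal_le_ofReal (hn c)
  have hlim : Tendsto (fun k => (n : ℝ≥0∞) * ∑ i, stalkNorm x (g i - fun _ => g i k))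
      atTop (𝓝 0) := by
    have h1 : Tendsto (fun k => ∑ i, stalkNorm x (g i - fun _ => g i k)) atTop (𝓝 0) := by
      simpa using tendsto_finsetSum Finset.univ fun i _ => hg i
    simpa using ENNReal.Tendsto.const_mul h1 (Or.inr (ENNReal.natCast_ne_top n))
  -- With `n` times the total error below `1`, a relation `c ≠ 0` at index `k` would give `‖c‖ ≤ n *
  -- ρ c ≤ ‖c‖ * (n * error) < ‖c‖`.
  obtain ⟨k, hk⟩ := (hlim.eventually_lt_const one_pos).exists
  refine ⟨k, linearIndependent_germ_iff.2 fun c hc => ?_⟩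
  by_contra hne
  have h1 : stalkNorm x (∑ i, c i • g i) ≤
      ‖c‖ₑ * ∑ i, stalkNorm x (g i - fun _ => g i k) := by
    have heq : ∑ i, c i • g i =
        (∑ i, c i • (g i - fun _ => g i k)) + ∑ i, c i • (fun _ => g i k : ℕ → M → ℝ) := by
      rw [← Finset.sum_add_distrib]
      simp [← smul_add]
    rw [heq]
    refine (stalkNorm_add_le _ _ _).trans ?_
    rw [hc, add_zero, Finset.mul_sum]
    refine (stalkNorm_sum_le _ _ _ _).trans (Finset.sum_le_sum fun i _ => ?_)
    gcongr
    rw [enorm_le_iff_norm_le]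
    exact norm_le_pi_norm c i
  have h2 : ‖c‖ₑ ≤ ‖c‖ₑ * (n * ∑ i, stalkNorm x (g i - fun _ => g i k)) := by
    refine (hn' c).trans ?_
    rw [mul_left_comm]
    gcongr
  have h3 : ‖c‖ₑ * (n * ∑ i, stalkNorm x (g i - fun _ => g i k)) < ‖c‖ₑ * 1 :=
    ENNReal.mul_lt_mul_right (by simpa using hne) enorm_ne_top hk
  rw [mul_one] at h3
  exact absurd h2 (not_le.2 h3)

theorem locLip_congr {f g : M → ℝ} {x : M} (h : f =ᶠ[𝓝 x] g) : locLip f x = locLip g x := by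
  unfold locLip
  refine limsup_congr ?_
  filter_upwards [h.filter_mono nhdsWithin_le_nhds] with y hy
  rw [hy, h.eq_of_nhds]

/-- Germs are local, so a Lipschitz function may be replaced by a truncation that lies in
`lipDomain`. -/
theorem germ_const_congr {f g : M → ℝ} {x : M} (h : f =ᶠ[𝓝 x] g) :
    germ x (fun _ => f) = germ x (fun _ => g) := by
  rw [germ_eq_germ]
  change stalkNorm x (fun _ => f - g) = 0
  rw [stalkNorm_const, ← locLip_zero x]
  apply locLip_congr
  filter_upwards [h] with y hy
  simp [hy]

end Stalk

end LipMod

/-! ### Pointwise values of elements of the module. -/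

namespace LipMod

variable {M : Type*} [MetricSpace M] [MeasurableSpace M] [BorelSpace M]
  {p : ℝ≥0∞} {m : Measure M}

theorem Pfm.locLip_toFun (F : Pfm p m) (x : M) :
    locLip (F.toFun x) x = ENNReal.ofReal (preNorm F.toFun x) :=
  (ENNReal.ofReal_toReal (F.isPiecewise.ne_top x)).symm

theorem Pfm.measurable_locLip_toFun (F : Pfm p m) : Measurable fun x => locLip (F.toFun x) x := by
  simp_rw [Pfm.locLip_toFun]
  exact F.isPiecewise.measurable_preNorm.ennreal_ofReal

/-- The values at `x` of a sequence in `Pfm`. -/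
def stalk (p : ℝ≥0∞) (m : Measure M) (x : M) : (ℕ → Pfm p m) →ₗ[ℝ] (ℕ → M → ℝ) where
  toFun G k := (G k).toFun x
  map_add' _ _ := rfl
  map_smul' _ _ := rfl

theorem stalk_const (x : M) (F : Pfm p m) : stalk p m x (fun _ => F) = fun _ => F.toFun x := rfl

theorem measurable_stalkNorm (G : ℕ → Pfm p m) :
    Measurable fun x => stalkNorm x (stalk p m x G) :=
  Measurable.limsup fun k => (G k).measurable_locLip_toFun

variable [Fact (1 ≤ p)]

namespace LipModule

theorem pnorm_smul (c : ℝ) (v : LipModule p m) : (c • v).pnorm = |c| • v.pnorm := by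
  induction v using UniformSpace.Completion.induction_on with
  | hp =>
    exact isClosed_eq (continuous_pnorm.comp (continuous_const_smul c))
      (continuous_pnorm.const_smul |c|)
  | ih F =>
    rw [← UniformSpace.Completion.coe_smul, pnorm_coe, pnorm_coe]
    apply Lp.ext
    filter_upwards [(c • F).coeFn_pnorm, F.coeFn_pnorm, Lp.coeFn_smul |c| F.pnorm] with x h1 h2 h3
    rw [h1, h3, Pi.smul_apply, h2, Pfm.toFun_smul, preNorm_smul, smul_eq_mul]

theorem pnorm_nonneg (v : LipModule p m) : 0 ≤ v.pnorm := by
  induction v using UniformSpace.Completion.induction_on with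
  | hp => exact isClosed_le continuous_const continuous_pnorm
  | ih F =>
    rw [pnorm_coe, ← Lp.coeFn_nonneg]
    filter_upwards [F.coeFn_pnorm] with x hx
    rw [hx]
    exact preNorm_nonneg _ _

theorem pnorm_add_le (v w : LipModule p m) : (v + w).pnorm ≤ v.pnorm + w.pnorm := by
  induction v, w using UniformSpace.Completion.induction_on₂ with
  | hp =>
    exact isClosed_le (continuous_pnorm.comp (continuous_fst.add continuous_snd))
      ((continuous_pnorm.comp continuous_fst).add (continuous_pnorm.comp continuous_snd))
  | ih F G =>
    rw [← UniformSpace.Completion.coe_add, pnorm_coe, pnorm_coe, pnorm_coe, ← Lp.coeFn_le]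
    filter_upwards [(F + G).coeFn_pnorm, F.coeFn_pnorm, G.coeFn_pnorm,
      Lp.coeFn_add F.pnorm G.pnorm] with x h1 h2 h3 h4
    rw [h1, h4, Pi.add_apply, h2, h3, Pfm.toFun_add]
    exact preNorm_add_le F.isPiecewise G.isPiecewise x

theorem pnorm_zero : (0 : LipModule p m).pnorm = 0 := by
  simpa using pnorm_smul 0 (0 : LipModule p m)

theorem ae_pnorm_zero : ((0 : LipModule p m).pnorm : M → ℝ) =ᵐ[m] 0 := by
  rw [pnorm_zero]
  exact Lp.coeFn_zero _ _ _

theorem ae_pnorm_nonneg (v : LipModule p m) : ∀ᵐ x ∂m, 0 ≤ v.pnorm x :=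
  (Lp.coeFn_nonneg _).2 v.pnorm_nonneg

theorem ae_pnorm_add_le (v w : LipModule p m) :
    ∀ᵐ x ∂m, (v + w).pnorm x ≤ v.pnorm x + w.pnorm x := by
  filter_upwards [(Lp.coeFn_le _ _).2 (pnorm_add_le v w), Lp.coeFn_add v.pnorm w.pnorm]
    with x h1 h2
  rwa [h2] at h1

theorem ae_pnorm_smul (c : ℝ) (v : LipModule p m) :
    ∀ᵐ x ∂m, (c • v).pnorm x = |c| * v.pnorm x := by
  rw [pnorm_smul]
  filter_upwards [Lp.coeFn_smul |c| v.pnorm] with x h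
  rw [h, Pi.smul_apply, smul_eq_mul]

theorem ae_pnorm_coe (F : Pfm p m) :
    ∀ᵐ x ∂m, pnorm (F : LipModule p m) x = preNorm F.toFun x := by
  rw [pnorm_coe]
  exact F.coeFn_pnorm

theorem ae_abs_pnorm_sub_le (v w : LipModule p m) :
    ∀ᵐ x ∂m, |v.pnorm x - w.pnorm x| ≤ (v - w).pnorm x := by
  have h := ae_pnorm_smul (-1) (v - w)
  rw [neg_one_smul, neg_sub] at h
  have h1 := ae_pnorm_add_le (v - w) w
  have h2 := ae_pnorm_add_le (w - v) v
  rw [sub_add_cancel] at h1 h2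
  filter_upwards [h, h1, h2] with x h h1 h2
  rw [h] at h2
  simp only [abs_neg, abs_one, one_mul] at h2
  rw [abs_le]
  constructor <;> linarith

end LipModule

/-- `G` converges to `v` almost everywhere in the pointwise norm. -/
def IsApprox (G : ℕ → Pfm p m) (v : LipModule p m) : Prop :=
  ∀ᵐ x ∂m, Tendsto (fun k => (v - (G k : LipModule p m)).pnorm x) atTop (𝓝 0)

theorem isApprox_const (F : Pfm p m) : IsApprox (fun _ => F) (F : LipModule p m) := by
  filter_upwards [LipModule.ae_pnorm_zero (p := p) (m := m)] with x hx
  simp [hx]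

theorem IsApprox.add {G H : ℕ → Pfm p m} {v w : LipModule p m} (hG : IsApprox G v)
    (hH : IsApprox H w) : IsApprox (G + H) (v + w) := by
  have h : ∀ᵐ x ∂m, ∀ k, ((v - (G k : LipModule p m)) + (w - (H k : LipModule p m))).pnorm x ≤
      (v - (G k : LipModule p m)).pnorm x + (w - (H k : LipModule p m)).pnorm x :=
    ae_all_iff.2 fun k => LipModule.ae_pnorm_add_le _ _
  have h0 : ∀ᵐ x ∂m, ∀ k,
      0 ≤ ((v - (G k : LipModule p m)) + (w - (H k : LipModule p m))).pnorm x :=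
    ae_all_iff.2 fun k => LipModule.ae_pnorm_nonneg _
  filter_upwards [hG, hH, h, h0] with x h1 h2 h3 h4
  have heq : ∀ k, v + w - (((G + H) k : Pfm p m) : LipModule p m) =
      (v - (G k : LipModule p m)) + (w - (H k : LipModule p m)) := by
    intro k
    rw [Pi.add_apply, UniformSpace.Completion.coe_add]
    abel
  simp_rw [heq]
  exact squeeze_zero h4 h3 (by simpa using h1.add h2)

theorem IsApprox.smul {G : ℕ → Pfm p m} {v : LipModule p m} (c : ℝ) (hG : IsApprox G v) :
    IsApprox (c • G) (c • v) := by
  have h : ∀ᵐ x ∂m, ∀ k, (c • (v - (G k : LipModule p m))).pnorm x =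
      |c| * (v - (G k : LipModule p m)).pnorm x :=
    ae_all_iff.2 fun k => LipModule.ae_pnorm_smul _ _
  filter_upwards [hG, h] with x h1 h2
  have heq : ∀ k, c • v - (((c • G) k : Pfm p m) : LipModule p m) =
      c • (v - (G k : LipModule p m)) := by
    intro k
    rw [Pi.smul_apply, UniformSpace.Completion.coe_smul, smul_sub]
  simp_rw [heq, h2]
  simpa using h1.const_mul |c|

theorem IsApprox.sub {G H : ℕ → Pfm p m} {v w : LipModule p m} (hG : IsApprox G v)
    (hH : IsApprox H w) : IsApprox (G - H) (v - w) := by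
  have := hG.add (hH.smul (-1))
  rwa [neg_one_smul, neg_one_smul, ← sub_eq_add_neg, ← sub_eq_add_neg] at this

theorem IsApprox.sum {ι : Type*} (s : Finset ι) {G : ι → ℕ → Pfm p m} {v : ι → LipModule p m}
    (c : ι → ℝ) (h : ∀ i, IsApprox (G i) (v i)) :
    IsApprox (∑ i ∈ s, c i • G i) (∑ i ∈ s, c i • v i) := by
  classical
  induction s using Finset.induction_on with
  | empty =>
    have h0 := isApprox_const (0 : Pfm p m)
    rw [UniformSpace.Completion.coe_zero] at h0
    rw [Finset.sum_empty, Finset.sum_empty]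
    exact h0
  | insert a s ha ih =>
    rw [Finset.sum_insert ha, Finset.sum_insert ha]
    exact ((h a).smul _).add ih

/-- By the reverse triangle inequality the pointwise norms of `G k` converge to `|v|_x`, so the
limsup is a limit. This turns `|v|_x` into a seminorm of an actual object at `x`. -/
theorem IsApprox.ae_stalkNorm {G : ℕ → Pfm p m} {v : LipModule p m} (h : IsApprox G v) :
    ∀ᵐ x ∂m, stalkNorm x (stalk p m x G) = ENNReal.ofReal (v.pnorm x) := by
  have h1 : ∀ᵐ x ∂m, ∀ k, |v.pnorm x - LipModule.pnorm (G k : LipModule p m) x| ≤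
      (v - (G k : LipModule p m)).pnorm x :=
    ae_all_iff.2 fun k => LipModule.ae_abs_pnorm_sub_le _ _
  have h2 : ∀ᵐ x ∂m, ∀ k, LipModule.pnorm (G k : LipModule p m) x = preNorm (G k).toFun x :=
    ae_all_iff.2 fun k => LipModule.ae_pnorm_coe _
  filter_upwards [h, h1, h2] with x h h1 h2
  simp_rw [h2] at h1
  have hlim : Tendsto (fun k => preNorm (G k).toFun x) atTop (𝓝 (v.pnorm x)) := by
    rw [tendsto_iff_dist_tendsto_zero]
    refine squeeze_zero (fun _ => dist_nonneg) (fun k => ?_) h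
    rw [dist_comm, Real.dist_eq]
    exact h1 k
  have := ENNReal.tendsto_ofReal hlim
  simp_rw [← Pfm.locLip_toFun] at this
  exact this.limsup_eq

theorem IsApprox.ae_stalkNorm_ne_top {G : ℕ → Pfm p m} {v : LipModule p m} (h : IsApprox G v) :
    ∀ᵐ x ∂m, stalkNorm x (stalk p m x G) ≠ ∞ := by
  filter_upwards [h.ae_stalkNorm] with x hx
  simp [hx]

theorem IsApprox.ae_germ_eq {G H : ℕ → Pfm p m} {v : LipModule p m} (hG : IsApprox G v)
    (hH : IsApprox H v) : ∀ᵐ x ∂m, germ x (stalk p m x G) = germ x (stalk p m x H) := by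
  have := hG.sub hH
  rw [sub_self] at this
  filter_upwards [this.ae_stalkNorm, LipModule.ae_pnorm_zero (p := p) (m := m)] with x h1 h2
  rw [germ_eq_germ, ← map_sub, h1, h2]
  simp

/-- For fixed `k`, the sequence `G - G k` approximates `v - G k`. This is the closeness needed to
pass from independent values to independent approximants. -/
theorem IsApprox.ae_tendsto {G : ℕ → Pfm p m} {v : LipModule p m} (h : IsApprox G v) :
    ∀ᵐ x ∂m, Tendsto (fun k => stalkNorm x (stalk p m x G - fun _ => stalk p m x G k))
      atTop (𝓝 0) := by
  have h1 : ∀ᵐ x ∂m, ∀ k, stalkNorm x (stalk p m x (G - fun _ => G k)) =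
      ENNReal.ofReal ((v - (G k : LipModule p m)).pnorm x) :=
    ae_all_iff.2 fun k => (h.sub (isApprox_const (G k))).ae_stalkNorm
  filter_upwards [h, h1] with x h h1
  simp_rw [map_sub] at h1
  change Tendsto (fun k => stalkNorm x (stalk p m x G - stalk p m x fun _ => G k)) atTop (𝓝 0)
  simp_rw [h1]
  simpa using ENNReal.tendsto_ofReal h

/-- Density of `Pfm` gives convergence in `L^p`, hence in measure, hence almost everywhere along a
subsequence. -/
theorem exists_isApprox (v : LipModule p m) : ∃ G : ℕ → Pfm p m, IsApprox G v := by
  obtain ⟨u, hu, hlim⟩ := mem_closure_iff_seq_limit.1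
    (UniformSpace.Completion.denseRange_coe v : v ∈ closure (Set.range _))
  choose F hF using hu
  have h1 : Tendsto (fun k => (v - (F k : LipModule p m)).pnorm) atTop (𝓝 0) := by
    have : Tendsto (fun k => v - u k) atTop (𝓝 0) := by
      simpa using (tendsto_const_nhds (x := v)).sub hlim
    have := (LipModule.continuous_pnorm.tendsto (0 : LipModule p m)).comp this
    rw [LipModule.pnorm_zero] at this
    simp_rw [hF]
    exact this
  obtain ⟨ns, -, hns⟩ := (tendstoInMeasure_of_tendsto_Lp h1).exists_seq_tendsto_ae
  refine ⟨fun k => F (ns k), ?_⟩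
  filter_upwards [hns, Lp.coeFn_zero ℝ p m] with x hx h0
  rwa [h0] at hx

/-- A sequence in `Pfm` that converges to `v` almost everywhere in the pointwise norm. -/
def LipModule.approx (v : LipModule p m) : ℕ → Pfm p m := (exists_isApprox v).choose

theorem LipModule.isApprox_approx (v : LipModule p m) : IsApprox v.approx v :=
  (exists_isApprox v).choose_spec

/-- The value of `v` at `x`, determined for almost every `x`. -/
def LipModule.value (x : M) (v : LipModule p m) : (ℕ → M → ℝ) ⧸ stalkKer x :=
  germ x (stalk p m x v.approx)

theorem LipModule.ae_value_coe (F : Pfm p m) :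
    ∀ᵐ x ∂m, value x (F : LipModule p m) = germ x (fun _ => F.toFun x) :=
  (LipModule.isApprox_approx (F : LipModule p m)).ae_germ_eq (isApprox_const F)

/-- Independence in the module is almost everywhere linear independence of the values. -/
theorem locallyIndependent_iff {S : Set (LipModule p m)} {A : Set M} :
    LocallyIndependent S A ↔ ∀ T : Finset (LipModule p m), (T : Set (LipModule p m)) ⊆ S →
      ∀ᵐ x ∂m, x ∈ A → LinearIndepOn ℝ (LipModule.value x) (T : Set (LipModule p m)) := by
  refine forall₂_congr fun T _ => ?_
  set g : M → T → ℕ → M → ℝ := fun x v => stalk p m x (v : LipModule p m).approx with hg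
  have hfin : ∀ᵐ x ∂m, ∀ v : T, stalkNorm x (g x v) ≠ ∞ :=
    ae_all_iff.2 fun v => (LipModule.isApprox_approx (v : LipModule p m)).ae_stalkNorm_ne_top
  have hval : ∀ c : T → ℝ, ∀ᵐ x ∂m,
      (LipModule.pnorm (∑ v : T, c v • (v : LipModule p m))) x = stalkSeminorm x (g x) c := by
    intro c
    have h1 := (IsApprox.sum Finset.univ c
      fun v : T => LipModule.isApprox_approx (v : LipModule p m)).ae_stalkNorm
    filter_upwards [hfin, h1, LipModule.ae_pnorm_nonneg (∑ v : T, c v • (v : LipModule p m))]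
      with x h2 h3 h4
    have h5 : stalk p m x (∑ v : T, c v • (v : LipModule p m).approx) = ∑ v, c v • g x v := by
      simp [hg]
    rw [h5, stalkSeminorm_apply h2] at h3
    exact ((ENNReal.ofReal_eq_ofReal_iff (apply_nonneg _ _) h4).1 h3).symm
  have hind : ∀ x, LinearIndepOn ℝ (LipModule.value x) (T : Set (LipModule p m)) ↔
      ∀ c : T → ℝ, stalkNorm x (∑ v, c v • g x v) = 0 → c = 0 := by
    intro x
    rw [← linearIndependent_germ_iff]
    rfl
  constructor
  · rintro ⟨ρ, hρ, hA⟩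
    -- For each `c` the two seminorms agree off a null set that depends on `c`. Rational vectors
    -- leave a common null set, and continuity gives the rest.
    have h1 : ∀ᵐ x ∂m, ∀ q : T → ℚ, ρ x (fun i => q i) = stalkSeminorm x (g x) (fun i => q i) := by
      refine ae_all_iff.2 fun q => ?_
      filter_upwards [hρ fun i => q i, hval fun i => q i] with x h2 h3
      rw [← h2, h3]
    filter_upwards [hA, h1, hfin] with x hA h1 hfin hx
    rw [hind]
    intro c hc
    rw [stalkSeminorm_apply hfin, ENNReal.ofReal_eq_zero] at hc
    apply hA hx
    have h2 : (fun c => ρ x c) = fun c => stalkSeminorm x (g x) c :=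
      (denseRange_ratCast_pi T).equalizer (continuous_seminorm_pi _)
        (continuous_seminorm_pi _) (funext h1)
    exact le_antisymm ((congrFun h2 c).trans_le hc) (apply_nonneg _ _)
  · intro h
    refine ⟨fun x => stalkSeminorm x (g x), hval, ?_⟩
    filter_upwards [h, hfin] with x h hfin hx c hc
    refine (hind x).1 (h hx) c ?_
    rw [stalkSeminorm_apply hfin, hc, ENNReal.ofReal_zero]

/-- The set where the germs of finitely many convergent sequences are independent is measurable,
up to a null set. -/
theorem exists_measurableSet_linearIndependent {ι : Type*} [Finite ι] {G : ι → ℕ → Pfm p m}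
    {v : ι → LipModule p m} (h : ∀ i, IsApprox (G i) (v i)) :
    ∃ I : Set M, MeasurableSet I ∧
      ∀ᵐ x ∂m, x ∈ I ↔ LinearIndependent ℝ (fun i => germ x (stalk p m x (G i))) := by
  cases nonempty_fintype ι
  refine ⟨{x | ∃ n : ℕ, ∀ q : ι → ℚ, ‖fun i => (q i : ℝ)‖ₑ ≤
    n * stalkNorm x (stalk p m x (∑ i, (q i : ℝ) • G i))}, ?_, ?_⟩
  · refine measurableSet_setOfPred.2 (.exists fun n => .forall fun q => measurableSet_setOfPred.1 ?_)
    exact measurableSet_le measurable_const ((measurable_stalkNorm _).const_mul _)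
  · filter_upwards [ae_all_iff.2 fun i => (h i).ae_stalkNorm_ne_top] with x hx
    rw [linearIndependent_germ_iff_rat hx]
    simp

/-- Independence is tested on finite subsets, so it survives unions of chains and Zorn's lemma
applies. -/
theorem exists_isMaximalIndependent {S : Set (LipModule p m)} {A : Set M}
    (hS : LocallyIndependent S A) (hSA : ∀ v ∈ S, SupportedOn v A) :
    ∃ S', S ⊆ S' ∧ IsMaximalIndependent S' A := by
  refine zorn_subset_nonempty
    {S' : Set (LipModule p m) | LocallyIndependent S' A ∧ ∀ v ∈ S', SupportedOn v A} ?_ S ⟨hS, hSA⟩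
  intro c hc hchain hne
  refine ⟨⋃₀ c, ⟨?_, ?_⟩, fun s hs => Set.subset_sUnion_of_mem hs⟩
  · intro T hT
    obtain ⟨s, hs, hTs⟩ := DirectedOn.exists_mem_subset_of_finite_of_subset_sUnion hne
      hchain.directedOn T.finite_toSet hT
    exact (hc hs).1 T hTs
  · rintro v ⟨s, hs, hv⟩
    exact (hc hs).2 v hv

end LipMod

/-! ### Countable covers, truncation and gluing. -/

namespace LipMod

/-- A class of measurable sets has a countable subfamily that covers each of its members up to a
null set. -/
theorem exists_seq_ae_cover {α : Type*} [MeasurableSpace α] (m : Measure α) [SFinite m]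
    (C : Set (Set α)) (hC : ∀ s ∈ C, MeasurableSet s) (hne : C.Nonempty) :
    ∃ B : ℕ → Set α, (∀ j, B j ∈ C) ∧ ∀ s ∈ C, m (s \ ⋃ j, B j) = 0 := by
  -- A finite measure with the same null sets allows cancellation below.
  set ν := m.toFinite
  set Φ : Set ℝ≥0∞ := {r | ∃ B : ℕ → Set α, (∀ j, B j ∈ C) ∧ r = ν (⋃ j, B j)} with hΦ
  obtain ⟨s₀, hs₀⟩ := hne
  have hΦne : Φ.Nonempty := ⟨_, fun _ => s₀, fun _ => hs₀, rfl⟩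
  obtain ⟨u, -, hlim, hu⟩ := exists_seq_tendsto_sSup hΦne (OrderTop.bddAbove Φ)
  choose B hB hBu using hu
  -- Merging a maximizing sequence of countable families into one family attains the supremum;
  -- prepending any `s` to it then adds no mass.
  set D : ℕ → Set α := fun k => B k.unpair.1 k.unpair.2 with hD
  have hDC : ∀ j, D j ∈ C := fun j => hB _ _
  have hsub : ∀ k, (⋃ j, B k j) ⊆ ⋃ j, D j := by
    intro k
    refine Set.iUnion_subset fun j => ?_
    refine Set.subset_iUnion_of_subset (Nat.pair k j) ?_
    simp [hD]
  have hsup : sSup Φ ≤ ν (⋃ j, D j) :=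
    le_of_tendsto' hlim fun k => (hBu k).trans_le (measure_mono (hsub k))
  refine ⟨D, hDC, fun s hs => absolutelyContinuous_toFinite m ?_⟩
  have hle : ν (s ∪ ⋃ j, D j) ≤ ν (⋃ j, D j) := by
    have hmem : ν (⋃ j : ℕ, (Nat.casesOn j s D : Set α)) ∈ Φ := by
      refine ⟨fun j => Nat.casesOn j s D, ?_, rfl⟩
      rintro (_ | j)
      · exact hs
      · exact hDC j
    refine le_trans (le_of_eq ?_) ((le_sSup hmem).trans hsup)
    congr 1
    ext x
    simp only [Set.mem_union, Set.mem_iUnion]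
    constructor
    · rintro (h | ⟨j, h⟩)
      exacts [⟨0, h⟩, ⟨j + 1, h⟩]
    · rintro ⟨_ | j, h⟩
      exacts [Or.inl h, Or.inr ⟨j, h⟩]
  have hDm : MeasurableSet (⋃ j, D j) := MeasurableSet.iUnion fun j => hC _ (hDC j)
  rw [← Set.sdiff_union_self, measure_union Set.disjoint_sdiff_left hDm] at hle
  exact le_zero_iff.1 ((ENNReal.add_le_add_iff_right (measure_ne_top ν _)).1
    (hle.trans_eq (zero_add _).symm))

variable {M : Type*} [MetricSpace M] [MeasurableSpace M] {p : ℝ≥0∞} {m : Measure M}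

theorem sigmaFinite_of_isBounded (hm : ∀ s : Set M, Bornology.IsBounded s → m s < ∞) :
    SigmaFinite m := by
  rcases isEmpty_or_nonempty M with hM | ⟨⟨x₀⟩⟩
  · rw [m.eq_zero_of_isEmpty]
    infer_instance
  · exact ⟨⟨⟨fun n => Metric.ball x₀ n, fun _ => trivial, fun n => hm _ Metric.isBounded_ball,
      Metric.iUnion_ball_nat x₀⟩⟩⟩

variable [BorelSpace M]

/-- On a ball, a Lipschitz function agrees with one of bounded support. -/
theorem exists_lipDomain_eventuallyEq (hm : ∀ s : Set M, Bornology.IsBounded s → m s < ∞)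
    {f : M → ℝ} (hf : ∃ K : ℝ≥0, LipschitzWith K f) (x₀ : M) (R : ℝ) :
    ∃ g ∈ lipDomain p m, ∀ x ∈ Metric.ball x₀ R, f =ᶠ[𝓝 x] g := by
  obtain ⟨K, hK⟩ := hf
  -- `f` is truncated to `[-h, h]` for a tent `h`. On the ball, `|f y| ≤ |f x₀| + K * R = L - R ≤ h
  -- y`, so nothing is cut there.
  set L : ℝ := |f x₀| + K * R + R with hL
  set h : M → ℝ := fun x => max 0 (L - dist x x₀) with hh
  have hhL : LipschitzWith 1 h := by
    have h1 : LipschitzWith 1 fun x => L - dist x x₀ := by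
      have := (LipschitzWith.const (α := M) L).sub (LipschitzWith.dist_left x₀)
      simpa using this
    exact h1.const_max 0
  have hnonneg : ∀ x, 0 ≤ h x := fun x => le_max_left _ _
  set g : M → ℝ := fun x => max (min (f x) (h x)) (-h x) with hg
  have hgL : LipschitzWith (max (max K 1) 1) g := (hK.min hhL).max hhL.neg
  have hg0 : ∀ x, L < dist x x₀ → g x = 0 := by
    intro x hx
    have : h x = 0 := max_eq_left (by linarith)
    simp [hg, this]
  refine ⟨g, ⟨⟨_, hgL⟩, ?_⟩, ?_⟩
  · have hB : m (Metric.closedBall x₀ L) ≠ ∞ := (hm _ Metric.isBounded_closedBall).ne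
    refine MemLp.mono (memLp_indicator_const p Metric.isClosed_closedBall.measurableSet
      ((max (max K 1) 1 : ℝ≥0) : ℝ) (Or.inr hB))
      (measurable_locLip hgL.continuous).ennreal_toReal.aestronglyMeasurable
      (Eventually.of_forall fun x => ?_)
    rw [Real.norm_of_nonneg ENNReal.toReal_nonneg]
    by_cases hx : x ∈ Metric.closedBall x₀ L
    · rw [Set.indicator_of_mem hx, Real.norm_of_nonneg (NNReal.coe_nonneg _)]
      exact ENNReal.toReal_mono ENNReal.coe_ne_top (locLip_le hgL x)
    · have : locLip g x = 0 := by
        rw [← locLip_zero x]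
        apply locLip_congr
        filter_upwards [Metric.isClosed_closedBall.isOpen_compl.mem_nhds hx] with y hy
        exact hg0 y (by simpa using hy)
      simp [this]
  · intro x hx
    filter_upwards [Metric.isOpen_ball.mem_nhds hx] with y hy
    have hy' : dist y x₀ < R := hy
    have h1 : |f y| ≤ h y := by
      have h2 := hK.dist_le_mul y x₀
      have h3 : (K : ℝ) * dist y x₀ ≤ K * R := by gcongr
      have h4 : |f y| - |f x₀| ≤ |f y - f x₀| := abs_sub_abs_le_abs_sub _ _
      rw [Real.dist_eq] at h2
      refine le_trans ?_ (le_max_right _ _)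
      linarith
    rw [abs_le] at h1
    simp only [hg]
    rw [min_eq_left h1.2, max_eq_left h1.1]

/-- A single function as an element of `Pfm`. -/
def Pfm.ofLip {f : M → ℝ} (hf : f ∈ lipDomain p m) : Pfm p m :=
  ⟨fun _ => f, by
    refine ⟨⟨fun k => if k = 0 then Set.univ else ∅, fun _ => f, ?_, ?_, ?_, fun _ => hf,
      fun _ _ _ => rfl⟩, hf.2⟩
    · intro i
      dsimp only
      split_ifs <;> simp
    · intro i j hij
      dsimp only
      split_ifs <;> simp_all
    · exact Set.eq_univ_of_forall fun x => Set.mem_iUnion.2 ⟨0, by simp⟩⟩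

/-- Countably many functions can be combined, after scaling, to an element of `Pfm`. -/
theorem exists_pfm_glue [hp1 : Fact (1 ≤ p)] (hp : p ≠ ∞) {P : ℕ → Set M}
    (hP : ∀ l, MeasurableSet (P l)) {g : ℕ → M → ℝ} (hg : ∀ l, g l ∈ lipDomain p m) :
    ∃ F : Pfm p m, (∀ x ∈ ⋃ l, P l, ∃ l, x ∈ P l ∧ ∃ ε : ℝ, ε ≠ 0 ∧ F.toFun x = ε • g l) ∧
      ∀ x ∉ ⋃ l, P l, F.toFun x = 0 := by
  classical
  have hp0 : p ≠ 0 := (zero_lt_one.trans_le hp1.out).ne'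
  have hpos : 0 < p.toReal := ENNReal.toReal_pos hp0 hp
  have hI : ∀ l, ∫⁻ x, locLip (g l) x ^ p.toReal ∂m ≠ ∞ := by
    intro l
    have h := (eLpNorm_lt_top_iff_lintegral_rpow_enorm_lt_top hp0 hp).1 (hg l).2.2
    obtain ⟨K, hK⟩ := (hg l).1
    have h2 : ∀ x, ‖(locLip (g l) x).toReal‖ₑ = locLip (g l) x := fun x => by
      rw [Real.enorm_of_nonneg ENNReal.toReal_nonneg,
        ENNReal.ofReal_toReal (ne_top_of_le_ne_top ENNReal.coe_ne_top (locLip_le hK x))]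
    simp_rw [h2] at h
    exact h.ne
  obtain ⟨δ, hδ, hsum⟩ := ENNReal.exists_pos_tsum_mul_lt_of_countable one_ne_zero _ hI
  -- Scaling by `δ ^ (1 / p)` multiplies the `p`-th power of `lip` by `δ`, which makes the integrals
  -- summable; nonzero factors do not affect independence.
  set ε : ℕ → ℝ≥0 := fun l => δ l ^ (p.toReal)⁻¹ with hε
  have hεpos : ∀ l, 0 < ε l := fun l => NNReal.rpow_pos (hδ l)
  -- Piece `0` is the complement of the union, with the zero function; `P l` is made disjoint and
  -- shifted to index `l + 1`.
  set A : ℕ → Set M := fun k => Nat.casesOn k (⋃ l, P l)ᶜ (disjointed P) with hA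
  set f : ℕ → M → ℝ := fun k => Nat.casesOn k 0 (fun l => (ε l : ℝ) • g l) with hf
  have hAm : ∀ k, MeasurableSet (A k) := by
    rintro (_ | l)
    · exact (MeasurableSet.iUnion hP).compl
    · exact MeasurableSet.disjointed hP l
  have hAsub : ∀ l, A (l + 1) ⊆ P l := fun l => disjointed_subset P l
  have hAd : Pairwise fun i j => Disjoint (A i) (A j) := by
    have h0 : ∀ l, Disjoint (A 0) (A (l + 1)) := fun l =>
      Set.disjoint_left.2 fun x hx hl => hx (Set.mem_iUnion.2 ⟨l, hAsub l hl⟩)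
    rintro (_ | i) (_ | j) hij
    · exact absurd rfl hij
    · exact h0 j
    · exact (h0 i).symm
    · exact disjoint_disjointed P (by simpa using hij)
  have hAU : ⋃ k, A k = Set.univ := by
    refine Set.eq_univ_of_forall fun x => ?_
    by_cases hx : x ∈ ⋃ l, P l
    · rw [← iUnion_disjointed] at hx
      obtain ⟨l, hl⟩ := Set.mem_iUnion.1 hx
      exact Set.mem_iUnion.2 ⟨l + 1, hl⟩
    · exact Set.mem_iUnion.2 ⟨0, hx⟩
  have hfd : ∀ k, f k ∈ lipDomain p m := by
    rintro (_ | l)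
    · exact ⟨⟨0, LipschitzWith.const 0⟩, by simp [hf, locLip_zero]⟩
    · exact lipDomain_smul _ (hg l)
  have hex : ∀ x, ∃ k, x ∈ A k := fun x =>
    Set.mem_iUnion.1 (hAU.symm ▸ Set.mem_univ x : x ∈ ⋃ k, A k)
  choose κ hκ using hex
  have huniq : ∀ x k, x ∈ A k → κ x = k := by
    intro x k hx
    by_contra hne
    exact Set.disjoint_left.1 (hAd hne) (hκ x) hx
  have hpw : IsPiecewise p m fun x => f (κ x) :=
    ⟨A, f, hAm, hAd, hAU, hfd, fun i x hx => congrArg f (huniq x i hx)⟩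
  have hbound : ∀ x, ‖preNorm (fun x => f (κ x)) x‖ₑ ^ p.toReal ≤
      ∑' l, locLip (g l) x ^ p.toReal * δ l := by
    intro x
    rw [Real.enorm_of_nonneg (preNorm_nonneg _ _), preNorm,
      ENNReal.ofReal_toReal (hpw.ne_top x)]
    rcases κ x with _ | l
    · simp [hf, locLip_zero, hpos]
    · refine le_trans (le_of_eq ?_) (ENNReal.le_tsum l)
      change locLip ((ε l : ℝ) • g l) x ^ p.toReal = _
      rw [locLip_smul, ENNReal.mul_rpow_of_nonneg _ _ hpos.le, mul_comm]
      congr 1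
      rw [Real.enorm_of_nonneg (NNReal.coe_nonneg _), ENNReal.ofReal_coe_nnreal,
        ← ENNReal.coe_rpow_of_nonneg _ hpos.le, hε]
      rw [NNReal.rpow_inv_rpow hpos.ne']
  have hmem : MemLp (preNorm fun x => f (κ x)) p m := by
    refine ⟨hpw.measurable_preNorm.aestronglyMeasurable, ?_⟩
    rw [eLpNorm_lt_top_iff_lintegral_rpow_enorm_lt_top hp0 hp]
    refine (lintegral_mono hbound).trans_lt ?_
    have hmeas : ∀ l, Measurable fun x => locLip (g l) x ^ p.toReal := fun l => by
      obtain ⟨K, hK⟩ := (hg l).1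
      exact (measurable_locLip hK.continuous).pow_const _
    rw [lintegral_tsum fun l => ((hmeas l).mul_const _).aemeasurable]
    rw [tsum_congr fun l => lintegral_mul_const (δ l : ℝ≥0∞) (hmeas l)]
    exact hsum.trans ENNReal.one_lt_top
  refine ⟨⟨fun x => f (κ x), hpw, hmem⟩, fun x hx => ?_, fun x hx => ?_⟩
  · rw [← iUnion_disjointed] at hx
    obtain ⟨l, hl⟩ := Set.mem_iUnion.1 hx
    refine ⟨l, hAsub l hl, ε l, (NNReal.coe_pos.2 (hεpos l)).ne', ?_⟩
    change f (κ x) = _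
    rw [huniq x (l + 1) hl]
  · change f (κ x) = _
    rw [huniq x 0 hx]
    rfl

theorem supportedOn_coe [Fact (1 ≤ p)] {F : Pfm p m} {A : Set M} (h : ∀ x ∉ A, F.toFun x = 0) :
    SupportedOn (F : LipModule p m) A := by
  filter_upwards [LipModule.ae_pnorm_coe F] with x hx hxA
  rw [hx, preNorm, h x hxA, locLip_zero, ENNReal.toReal_zero]

end LipMod

/-! ### Charts, maximal independent sets and the dimension partition. -/

namespace LipMod

variable {M : Type*} [MetricSpace M] [MeasurableSpace M] {p : ℝ≥0∞} {m : Measure M}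

theorem lipIndependent_iff {n : ℕ} {f : Fin n → M → ℝ} {A : Set M} :
    LipIndependent m f A ↔
      ∀ᵐ x ∂m, x ∈ A → LinearIndependent ℝ fun i => germ x (fun _ => f i) := by
  simp_rw [linearIndependent_germ_const_iff]
  rfl

/-- `A` is a Borel set on which some `n` Lipschitz functions are independent. -/
def IsLipChart (m : Measure M) (n : ℕ) (A : Set M) : Prop :=
  MeasurableSet A ∧ ∃ f : Fin n → M → ℝ, (∀ i, ∃ K : ℝ≥0, LipschitzWith K (f i)) ∧
    LipIndependent m f A

theorem isLipschitzDifferentiabilitySpace_iff {N : ℕ} :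
    IsLipschitzDifferentiabilitySpace m N ↔
      ∀ n A, IsLipChart m n A → m A ≠ 0 → n ≤ N :=
  ⟨fun h n A ⟨hA, f, hf, hfA⟩ hA0 => h n f hf A hA hA0 hfA,
    fun h n f hf A hA hA0 hfA => h n A ⟨hA, f, hf, hfA⟩ hA0⟩

theorem IsLipChart.empty (m : Measure M) (n : ℕ) : IsLipChart m n ∅ :=
  ⟨MeasurableSet.empty, fun _ => 0, fun _ => ⟨0, LipschitzWith.const 0⟩,
    Eventually.of_forall fun _ h => h.elim⟩

variable [BorelSpace M] [hp1 : Fact (1 ≤ p)]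

/-- Independent elements of the module yield as many independent Lipschitz functions on a
smaller set. -/
theorem LocallyIndependent.exists_isLipChart {T : Finset (LipModule p m)} {A : Set M}
    (hT : LocallyIndependent (T : Set (LipModule p m)) A) (hA : MeasurableSet A) (hA0 : m A ≠ 0) :
    ∃ B ⊆ A, m B ≠ 0 ∧ IsLipChart m T.card B := by
  have hT' := locallyIndependent_iff.1 hT T subset_rfl
  choose P f hP _ hPU hf hPf using fun (v : T) (k : ℕ) =>
    ((v : LipModule p m).approx k).isPiecewise
  choose I hI hIae using fun k : ℕ => exists_measurableSet_linearIndependent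
    (fun v : T => isApprox_const ((v : LipModule p m).approx k))
  -- On `B (k, l)` the `k`-th approximants are independent, and that of `v` is the single Lipschitz
  -- function `f v k (l v)`. There are countably many such sets.
  set B : ℕ × (T → ℕ) → Set M := fun kl => A ∩ I kl.1 ∩ ⋂ v, P v kl.1 (kl.2 v) with hB
  have hfin : ∀ᵐ x ∂m, ∀ v : T,
      stalkNorm x (stalk p m x (v : LipModule p m).approx) ≠ ∞ :=
    ae_all_iff.2 fun v => (LipModule.isApprox_approx (v : LipModule p m)).ae_stalkNorm_ne_top
  have hlim : ∀ᵐ x ∂m, ∀ v : T, Tendsto (fun k => stalkNorm x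
      (stalk p m x (v : LipModule p m).approx -
        fun _ => stalk p m x (v : LipModule p m).approx k)) atTop (𝓝 0) :=
    ae_all_iff.2 fun v => (LipModule.isApprox_approx (v : LipModule p m)).ae_tendsto
  have hcover : ∀ᵐ x ∂m, x ∈ A → x ∈ ⋃ kl, B kl := by
    filter_upwards [hT', hfin, hlim, ae_all_iff.2 hIae] with x h1 h2 h3 h4 hx
    obtain ⟨k, hk⟩ := exists_linearIndependent_germ_const h2 h3 (h1 hx)
    have hl : ∀ v : T, ∃ l, x ∈ P v k l := fun v =>
      Set.mem_iUnion.1 ((hPU v k).symm ▸ Set.mem_univ x)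
    choose l hl using hl
    exact Set.mem_iUnion.2 ⟨(k, l), ⟨hx, (h4 k).2 hk⟩, Set.mem_iInter.2 hl⟩
  obtain ⟨⟨k, l⟩, hkl⟩ : ∃ kl, m (B kl) ≠ 0 := by
    by_contra! h
    exact hA0 (measure_mono_null_ae hcover (measure_iUnion_null h))
  refine ⟨B (k, l), fun x hx => hx.1.1, hkl, ?_, fun i => f (T.equivFin.symm i) k
    (l (T.equivFin.symm i)), fun i => (hf _ _ _).1, lipIndependent_iff.2 ?_⟩
  · exact (hA.inter (hI k)).inter (MeasurableSet.iInter fun v => hP v k (l v))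
  · filter_upwards [hIae k] with x hx hxB
    have hx' := (hx.1 hxB.1.2).comp _ T.equivFin.symm.injective
    convert hx' using 2 with i
    simp only [Function.comp]
    rw [stalk_const, hPf _ k _ x (Set.mem_iInter.1 hxB.2 _)]

/-- If `A` carries more independent Lipschitz functions than `T` has elements, then some element
of `Pfm` is almost everywhere on `A` independent of `T`. -/
theorem exists_pfm_notMem_span (hp : p ≠ ∞)
    (hm : ∀ s : Set M, Bornology.IsBounded s → m s < ∞)
    {T : Finset (LipModule p m)} {A : Set M} (hA : MeasurableSet A) (hA0 : m A ≠ 0)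
    (hT : LocallyIndependent (T : Set (LipModule p m)) A) {n : ℕ} (hn : T.card < n)
    {B : ℕ → Set M} (hB : ∀ j, IsLipChart m n (B j)) (hAB : A ⊆ ⋃ j, B j) :
    ∃ F : Pfm p m, SupportedOn (F : LipModule p m) A ∧ ∀ᵐ x ∂m, x ∈ A →
      germ x (fun _ => F.toFun x) ∉
        Submodule.span ℝ (LipModule.value x '' (T : Set (LipModule p m))) := by
  obtain ⟨x₀, -⟩ := nonempty_of_measure_ne_zero hA0
  choose hBm f hf hfB using hB
  choose g hgd hfg using fun (j : ℕ) (R : ℕ) (i : Fin n) =>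
    exists_lipDomain_eventuallyEq (p := p) hm (hf j i) x₀ R
  -- A candidate is given by a chart, a truncation radius and a coordinate. `none` adjoins it to
  -- `T`, so `I a` is where the enlarged family is independent.
  choose I hI hIae using fun a : ℕ × ℕ × Fin n => exists_measurableSet_linearIndependent
    (G := fun o : Option T => o.elim (fun _ => Pfm.ofLip (hgd a.1 a.2.1 a.2.2))
      fun v => (v : LipModule p m).approx)
    (v := fun o : Option T => o.elim (Pfm.ofLip (hgd a.1 a.2.1 a.2.2) : LipModule p m)
      fun v => (v : LipModule p m)) (by
        rintro (_ | v)
        · exact isApprox_const _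
        · exact LipModule.isApprox_approx _)
  have hIae' : ∀ᵐ x ∂m, ∀ a : ℕ × ℕ × Fin n, x ∈ I a ↔
      LinearIndepOn ℝ (LipModule.value x) (T : Set (LipModule p m)) ∧
        germ x (fun _ => g a.1 a.2.1 a.2.2) ∉
          Submodule.span ℝ (LipModule.value x '' (T : Set (LipModule p m))) := by
    filter_upwards [ae_all_iff.2 hIae] with x hx a
    have hfam : (fun o : Option T => germ x (stalk p m x
        (o.elim (fun _ => Pfm.ofLip (hgd a.1 a.2.1 a.2.2)) fun v => (v : LipModule p m).approx))) =
        fun o => o.casesOn' (germ x fun _ => g a.1 a.2.1 a.2.2)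
          fun v : T => LipModule.value x (v : LipModule p m) := by
      funext o
      cases o <;> rfl
    rw [hx a, hfam, linearIndependent_option', Set.image_eq_range]
    rfl
  have : Nonempty (Fin n) := ⟨⟨0, by omega⟩⟩
  obtain ⟨σ, hσ⟩ := exists_surjective_nat (ℕ × ℕ × Fin n)
  obtain ⟨F, hF, hF0⟩ := exists_pfm_glue hp (P := fun l => A ∩ I (σ l))
    (fun l => hA.inter (hI _)) fun l => hgd (σ l).1 (σ l).2.1 (σ l).2.2
  refine ⟨F, supportedOn_coe fun x hx => hF0 x fun h => ?_, ?_⟩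
  · obtain ⟨l, hl⟩ := Set.mem_iUnion.1 h
    exact hx hl.1
  filter_upwards [hIae', locallyIndependent_iff.1 hT T subset_rfl,
    ae_all_iff.2 fun j => lipIndependent_iff.1 (hfB j)] with x h1 h2 h3 hx
  obtain ⟨j, hj⟩ := Set.mem_iUnion.1 (hAB hx)
  obtain ⟨R, hR⟩ := exists_nat_gt (dist x x₀)
  set W := Submodule.span ℝ (LipModule.value x '' (T : Set (LipModule p m))) with hW
  -- Dimension count: `n` independent germs do not fit into a span of `T.card < n` vectors.
  obtain ⟨i, hi⟩ : ∃ i, germ x (fun _ => f j i) ∉ W := by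
    by_contra! h
    have hspan : Submodule.span ℝ (Set.range fun i => germ x (fun _ => f j i)) ≤ W :=
      Submodule.span_le.2 (Set.range_subset_iff.2 h)
    have : FiniteDimensional ℝ W :=
      FiniteDimensional.span_of_finite ℝ (T.finite_toSet.image _)
    have h4 := Submodule.finrank_mono hspan
    rw [finrank_span_eq_card (h3 j hj), Fintype.card_fin, hW, Set.image_eq_range] at h4
    have h5 := finrank_range_le_card (R := ℝ) fun v : T => LipModule.value x (v : LipModule p m)
    rw [Fintype.card_coe] at h5
    exact absurd (h4.trans h5) (not_le.2 hn)
  have hxI : x ∈ I (j, R, i) := by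
    refine (h1 _).2 ⟨h2 hx, ?_⟩
    rwa [← germ_const_congr (hfg j R i x (by simpa using hR))]
  obtain ⟨l₀, hl₀⟩ := hσ (j, R, i)
  -- The glued function may come from a candidate other than `(j, R, i)`, but any one whose set `I`
  -- contains `x` lies outside the span.
  obtain ⟨l, hl, ε, hε, hFx⟩ := hF x (Set.mem_iUnion.2 ⟨l₀, hx, by rwa [hl₀]⟩)
  rw [hFx]
  change germ x (ε • fun _ => g _ _ _) ∉ W
  rw [map_smul, Submodule.smul_mem_iff _ hε]
  exact ((h1 _).1 hl.2).2

/-- The cardinality of maximal independent sets is determined by Lipschitz charts. -/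
theorem IsMaximalIndependent.encard_eq (hp : p ≠ ∞)
    (hm : ∀ s : Set M, Bornology.IsBounded s → m s < ∞) {A : Set M} (hA : MeasurableSet A)
    (hA0 : m A ≠ 0) {n : ℕ} (hup : ∀ B ⊆ A, IsLipChart m (n + 1) B → m B = 0)
    (hlow : n ≠ 0 → ∃ B : ℕ → Set M, (∀ j, IsLipChart m n (B j)) ∧ A ⊆ ⋃ j, B j)
    {S : Set (LipModule p m)} (hS : IsMaximalIndependent S A) : S.encard = n := by
  have hmonoS : ∀ T : Finset (LipModule p m), (T : Set (LipModule p m)) ⊆ S →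
      LocallyIndependent (T : Set (LipModule p m)) A := fun T hT T' hT' =>
    hS.prop.1 T' (hT'.trans hT)
  apply le_antisymm
  · by_contra! hlt
    have hle : ((n + 1 : ℕ) : ℕ∞) ≤ S.encard := by
      push_cast
      exact Order.add_one_le_of_lt hlt
    obtain ⟨T, hTS, hT⟩ := Set.exists_subset_encard_eq hle
    have hTfin : T.Finite := Set.finite_of_encard_eq_coe hT
    have hcard : hTfin.toFinset.card = n + 1 := by
      rw [hTfin.encard_eq_coe_toFinset_card] at hT
      exact_mod_cast hT
    obtain ⟨B, hBA, hB0, hB⟩ := (hmonoS hTfin.toFinset (by simpa using hTS)).exists_isLipChart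
      hA hA0
    rw [hcard] at hB
    exact hB0 (hup B hBA hB)
  · by_contra! hlt
    have hfin : S.Finite := Set.finite_of_encard_le_coe hlt.le
    rw [hfin.encard_eq_coe_toFinset_card] at hlt
    have hcard : hfin.toFinset.card < n := by exact_mod_cast hlt
    obtain ⟨B, hB, hAB⟩ := hlow (by omega)
    obtain ⟨F, hFA, hF⟩ := exists_pfm_notMem_span hp hm hA hA0
      (hmonoS hfin.toFinset (by simp)) hcard hB hAB
    rw [hfin.coe_toFinset] at hF
    have hF' : ∀ᵐ x ∂m, x ∈ A → LipModule.value x (F : LipModule p m) ∉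
        Submodule.span ℝ (LipModule.value x '' S) := by
      filter_upwards [hF, LipModule.ae_value_coe F] with x h1 h2
      rwa [h2]
    have hFS : (F : LipModule p m) ∉ S := by
      intro h
      apply hA0
      refine measure_mono_null_ae (t := ∅) ?_ measure_empty
      filter_upwards [hF'] with x hx hxA
      exact hx hxA (Submodule.subset_span (Set.mem_image_of_mem _ h))
    refine hFS (hS.le_of_ge ⟨locallyIndependent_iff.2 fun T hT => ?_, ?_⟩
      (Set.subset_insert (F : LipModule p m) S) (Set.mem_insert _ _))
    · filter_upwards [hF', locallyIndependent_iff.1 hS.prop.1 hfin.toFinset (by simp)]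
        with x h1 h2 hx
      have h3 := h2 hx
      rw [hfin.coe_toFinset] at h3
      exact ((linearIndepOn_insert hFS).2 ⟨h3, h1 hx⟩).mono hT
    · rintro v (rfl | hv)
      exacts [hFA, hS.prop.2 v hv]

/-- `U n` is the essential union of all `n`-charts and `d x` is the supremum of the `n` with `x ∈ U
n`; the partition consists of the level sets of `d`. -/
theorem IsLipschitzDifferentiabilitySpace.lipModuleLocallyFiniteDimensional (hp : p ≠ ∞)
    (hm : ∀ s : Set M, Bornology.IsBounded s → m s < ∞) {N : ℕ}
    (h : IsLipschitzDifferentiabilitySpace m N) : LipModuleLocallyFiniteDimensional p m N := by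
  rw [isLipschitzDifferentiabilitySpace_iff] at h
  have := sigmaFinite_of_isBounded hm
  choose B hB hBcov using fun n : ℕ => exists_seq_ae_cover m {A | IsLipChart m n A}
    (fun _ hA => hA.1) ⟨∅, IsLipChart.empty m n⟩
  set U : ℕ → Set M := fun n => ⋃ j, B n j with hU
  have hUm : ∀ n, MeasurableSet (U n) := fun n => MeasurableSet.iUnion fun j => (hB n j).1
  have hU0 : ∀ n, N < n → m (U n) = 0 := fun n hn => measure_iUnion_null fun j => by
    by_contra h0
    exact absurd (h n _ (hB n j) h0) (not_le.2 hn)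
  set d : M → ℕ∞ := fun x => ⨆ (n : ℕ) (_ : x ∈ U n), (n : ℕ∞) with hd
  have hdle : ∀ x a, d x ≤ a ↔ ∀ n : ℕ, x ∈ U n → (n : ℕ∞) ≤ a := fun x a => iSup₂_le_iff
  have hdm : ∀ a, MeasurableSet {x | d x ≤ a} := by
    intro a
    simp_rw [hdle]
    exact measurableSet_setOfPred.2 (.forall fun n => (measurableSet_setOfPred.1 (hUm n)).imp
      measurable_const)
  -- The case `n = 0` is excluded because `d x = 0` also when `x` lies in no `U k`.
  have hmem : ∀ x (n : ℕ), d x = n → n ≠ 0 → x ∈ U n := by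
    intro x n hx hn
    by_contra hxn
    have : d x ≤ ((n - 1 : ℕ) : ℕ∞) := by
      refine (hdle x _).2 fun k hk => ?_
      have h1 : (k : ℕ∞) ≤ n := (hdle x n).1 hx.le k hk
      have h2 : k ≤ n := by exact_mod_cast h1
      have h3 : k ≠ n := fun h => hxn (h ▸ hk)
      exact_mod_cast (by omega : k ≤ n - 1)
    rw [hx] at this
    have h4 : n ≤ n - 1 := by exact_mod_cast this
    omega
  have hnull : ∀ n : ℕ, N < n → m (d ⁻¹' {(n : ℕ∞)}) = 0 := fun n hn =>
    measure_mono_null (fun x hx => hmem x n hx (by omega)) (hU0 n hn)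
  refine ⟨fun e => d ⁻¹' {e}, ?_, ?_, ?_, ?_, ?_, hnull⟩
  · intro e
    have : d ⁻¹' {e} = {x | d x ≤ e} \ ⋃ (a : ℕ∞) (_ : a < e), {x | d x ≤ a} := by
      ext x
      simp only [Set.mem_preimage, Set.mem_singleton_iff, Set.mem_sdiff, Set.mem_ofPred_eq,
        Set.mem_iUnion, not_exists, not_le]
      constructor
      · rintro rfl
        exact ⟨le_rfl, fun a ha => ha⟩
      · rintro ⟨h1, h2⟩
        by_contra hne
        exact lt_irrefl _ (h2 _ (lt_of_le_of_ne h1 hne))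
    change MeasurableSet (d ⁻¹' {e})
    rw [this]
    exact (hdm e).diff (MeasurableSet.iUnion fun a => MeasurableSet.iUnion fun _ => hdm a)
  · intro i j hij
    exact Disjoint.preimage d (Set.disjoint_singleton.2 hij)
  · exact Set.eq_univ_of_forall fun x => Set.mem_iUnion.2 ⟨d x, rfl⟩
  · refine measure_mono_null (fun x hx => ?_)
      (measure_iUnion_null fun k : ℕ => hU0 (N + 1 + k) (by omega))
    by_contra hxU
    have hle : d x ≤ (N : ℕ∞) := by
      refine (hdle x _).2 fun k hk => ?_
      by_contra! hlt
      have hlt' : N < k := by exact_mod_cast hlt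
      refine hxU (Set.mem_iUnion.2 ⟨k - (N + 1), ?_⟩)
      rwa [Nat.add_sub_cancel' hlt']
    rw [show d x = ⊤ from hx] at hle
    exact ENat.natCast_ne_top N (top_le_iff.1 hle)
  · intro n A hAE hA hA0 S hS
    refine hS.encard_eq hp hm hA hA0 (fun C hCA hC => ?_) fun hn => ⟨B n, hB n, fun x hx =>
      hmem x n (hAE hx) hn⟩
    -- An `(n + 1)`-chart inside `{d = n}` misses `U (n + 1)`, which covers it up to a null set.
    refine measure_mono_null (t := C \ U (n + 1)) (fun x hx => ⟨hx, fun hxU => ?_⟩)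
      (hBcov (n + 1) C hC)
    have h1 := (hdle x n).1 (hAE (hCA hx)).le (n + 1) hxU
    have h2 : n + 1 ≤ n := by exact_mod_cast h1
    omega

/-- Independent functions, cut off to a non-null bounded part `C` of some `E e`, become independent
module elements; a maximal set containing them has `e ≤ N` elements. -/
theorem LipModuleLocallyFiniteDimensional.isLipschitzDifferentiabilitySpace (hp : p ≠ ∞)
    (hm : ∀ s : Set M, Bornology.IsBounded s → m s < ∞) {N : ℕ}
    (h : LipModuleLocallyFiniteDimensional p m N) : IsLipschitzDifferentiabilitySpace m N := by
  obtain ⟨E, hEm, -, hEU, hEtop, hEmax, hEN⟩ := h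
  intro n f hf A hA hA0 hfA
  obtain ⟨x₀, -⟩ := nonempty_of_measure_ne_zero hA0
  obtain ⟨⟨e, R⟩, hC0⟩ : ∃ eR : ℕ∞ × ℕ, m (A ∩ E eR.1 ∩ Metric.ball x₀ eR.2) ≠ 0 := by
    by_contra! h
    refine hA0 (measure_mono_null (fun x hx => ?_) (measure_iUnion_null h))
    obtain ⟨e, he⟩ := Set.mem_iUnion.1 (hEU.symm ▸ Set.mem_univ x : x ∈ ⋃ e, E e)
    obtain ⟨R, hR⟩ := exists_nat_gt (dist x x₀)
    exact Set.mem_iUnion.2 ⟨(e, R), ⟨hx, he⟩, hR⟩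
  set C := A ∩ E e ∩ Metric.ball x₀ (R : ℝ) with hC
  have hCm : MeasurableSet C := (hA.inter (hEm e)).inter measurableSet_ball
  have hE0 : m (E e) ≠ 0 := fun h0 => hC0 (measure_mono_null (fun x hx => hx.1.2) h0)
  lift e to ℕ using fun he => hE0 (he ▸ hEtop)
  have heN : e ≤ N := by
    by_contra! hlt
    exact hE0 (hEN e hlt)
  choose g hgd hfg using fun i => exists_lipDomain_eventuallyEq (p := p) hm (hf i) x₀ R
  choose F hF hF0 using fun i => exists_pfm_glue hp (P := fun _ => C) (fun _ => hCm)
    fun _ => hgd i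
  have hC' : (⋃ _ : ℕ, C) = C := Set.iUnion_const C
  simp_rw [hC'] at hF hF0
  set w : Fin n → LipModule p m := fun i => (F i : LipModule p m) with hw
  have hind : ∀ᵐ x ∂m, x ∈ C → LinearIndependent ℝ fun i => LipModule.value x (w i) := by
    filter_upwards [lipIndependent_iff.1 hfA,
      ae_all_iff.2 fun i => LipModule.ae_value_coe (F i)] with x h1 h2 hx
    choose _ _ ε hε hFx using fun i => hF i x hx
    have h3 := (h1 hx.1.1).units_smul fun i => Units.mk0 (ε i) (hε i)
    convert h3 using 2 with i
    rw [h2, hFx, Pi.smul_apply', germ_const_congr (hfg i x hx.2)]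
    exact map_smul (germ x) (ε i) fun _ => g i
  -- Injectivity makes `Set.range w` have `n` elements; equal members would have equal values on
  -- `C`.
  have hwinj : Function.Injective w := by
    intro i j hij
    by_contra hne
    apply hC0
    refine measure_mono_null_ae (t := ∅) ?_ measure_empty
    filter_upwards [hind] with x hx hxC
    exact hne ((hx hxC).injective (by rw [hij]))
  have hS : LocallyIndependent (Set.range w) C := by
    refine locallyIndependent_iff.2 fun T hT => ?_
    filter_upwards [hind] with x hx hxC
    exact ((linearIndepOn_range_iff hwinj _).2 (hx hxC)).mono hT
  obtain ⟨S, hwS, hSmax⟩ := exists_isMaximalIndependent hS (by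
    rintro _ ⟨i, rfl⟩
    exact supportedOn_coe (hF0 i))
  have hcard := hEmax e C (fun x hx => hx.1.2) hCm hC0 S hSmax
  have hle := Set.encard_le_encard hwS
  rw [hcard, ← Set.image_univ, hwinj.encard_image, Set.encard_univ, ENat.card_eq_coe_fintype_card,
    Fintype.card_fin] at hle
  exact (by exact_mod_cast hle : n ≤ e).trans heN

end LipMod

end

theorem mainTheorem6 {M : Type*} [MetricSpace M] [CompleteSpace M] [MeasurableSpace M]
    [BorelSpace M] (m : Measure M) [m.Regular]
    (hm : ∀ s : Set M, Bornology.IsBounded s → m s < ∞) (N : ℕ) :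
    (LipMod.IsLipschitzDifferentiabilitySpace m N ↔
      ∃ (p : ℝ≥0∞) (_ : Fact (1 ≤ p)), 1 < p ∧ p < ∞ ∧
        LipMod.LipModuleLocallyFiniteDimensional p m N) ∧
    (LipMod.IsLipschitzDifferentiabilitySpace m N ↔
      ∀ (p : ℝ≥0∞) [Fact (1 ≤ p)], 1 < p → p < ∞ →
        LipMod.LipModuleLocallyFiniteDimensional p m N) := by
  -- The exponent `2` is an arbitrary choice in `(1, ∞)`.
  have h2 : (1 : ℝ≥0∞) < 2 := ENNReal.one_lt_two
  have h2' : (2 : ℝ≥0∞) < ∞ := ENNReal.ofNat_lt_top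
  have : Fact ((1 : ℝ≥0∞) ≤ 2) := ⟨h2.le⟩
  refine ⟨⟨fun h => ⟨2, inferInstance, h2, h2', h.lipModuleLocallyFiniteDimensional h2'.ne hm⟩, ?_⟩,
    fun h p _ _ hp => h.lipModuleLocallyFiniteDimensional hp.ne hm, fun h => ?_⟩
  · rintro ⟨p, _, -, hp, h⟩
    exact h.isLipschitzDifferentiabilitySpace hp.ne hm
  · exact (h 2 h2 h2').isLipschitzDifferentiabilitySpace h2'.ne hm
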